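/- Let $N\ge 3$, let $\eta=(\eta_{\alpha\beta})_{1\le\alpha,\beta\le N}$ be a nondegenerate symmetric real matrix with inverse $(\eta^{\alpha\beta})$, and fix $p$ with $2\le p\le N$. For a function $F(t^1,\dots,t^N)$ with $F_{1\alpha\beta}=\eta_{\alpha\beta}$ (subscripts denote partial derivatives) put $$S_{\alpha\beta\gamma\nu}=\eta^{\lambda\mu}\,(F_{\lambda\alpha\beta}F_{\mu\gamma\nu}-F_{\lambda\alpha\nu}F_{\mu\gamma\beta});$$ the WDVV equations are $S_{\alpha\beta\gamma\nu}=0$. Let $I=(m,i)=(i,m)$, $2\le i\le m\le N$, denote the $n=N(N-1)/2$ index pairs, and put $u^{(m,i)}_\lambda=F_{\lambda im}$. Write also $\gamma=(\nu,\beta+1)$ with $1\le\beta<\nu\le N$, and define constants as follows, where $\delta_{k,(a,b)}$ is $1$ if $k=(a,b)=(b,a)$ and $0$ otherwise. For $\beta\ge2$: $$\psi^\gamma_{km}=\sum_{a,b\ge2}\eta^{ab}\bigl(\delta_{k,(\nu,a)}\delta_{m,(\beta,b)}-\delta_{k,(\beta,b)}\delta_{m,(\nu,a)}\bigr),$$ $${}_\rho\omega^\gamma_k=\sum_{a\ge2}\eta^{1a}\bigl(\eta_{\rho\beta}\,\delta_{k,(\nu,a)}-\eta_{\rho\nu}\,\delta_{k,(\beta,a)}\bigr),\qquad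 {}_{\lambda\mu}\xi^\gamma=-\eta^{11}(\eta_{\lambda\beta}\eta_{\mu\nu}-\eta_{\lambda\nu}\eta_{\mu\beta}).$$ For $\beta=1$: $\psi^\gamma_{km}=0$, ${}_\rho\omega^\gamma_k=\delta_{k,(\nu,\rho)}$, ${}_{\lambda\mu}\xi^\gamma=0$. Put $$\psi^\gamma_k(u)=\psi^\gamma_{km}u^m+{}_p\omega^\gamma_k,\quad Z^\gamma_\mu(u)={}_\mu\omega^\gamma_ku^k+{}_{p\mu}\xi^\gamma,\quad \phi_{(A,a)(B,b)}=\eta^{AB}\eta^{(a-1)(b-1)}-\eta^{A(b-1)}\eta^{B(a-1)},$$ $$f_{ij}(u)=\phi_{\alpha\beta}\,\psi^\alpha_i(u)\,\psi^\beta_j(u),\qquad V_\mu(u)=\psi(u)^{-1}Z_\mu(u).$$ Then: 1. The polynomial $\det\psi(u)$ is not identically zero, and $f$ is a Monge metric: it is symmetric, generically nondegenerate, and $f_{mk,s}+f_{ks,m}+f_{ms,k}=0$, where $f_{ij,k}=\partial f_{ij}/\partial u^k$. 2. The third-order Doyle--Potëmin operator defined by $f$, $$A_2^{ij}=D_x\circ(f^{ij}D_x+c^{ij}_ku^k_x)\circ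 D_x,\qquad (f^{ij})=(f_{ij})^{-1},\quad c_{ijk}=f_{iq}f_{jp'}c^{p'q}_k,\quad c_{skm}=\tfrac13(f_{sm,k}-f_{sk,m}),$$ is Hamiltonian: it is formally skew-adjoint, and the bracket $\{F,G\}=\int\frac{\delta F}{\delta u^i}A_2^{ij}\frac{\delta G}{\delta u^j}\,dx$ of functionals, whose densities are rational functions of $x$, the $u^i$ and their $x$-derivatives, satisfies the Jacobi identity. 3. For each of the $N-2$ indices $\mu$ with $2\le\mu\le N$, $\mu\ne p$, the system of conservation laws $(u^I_p)_\mu=(V^I_\mu(u_p))_p$, $I=1,\dots,n$ (in which $x=t^p$ and $t^\mu$ is the time), is Hamiltonian with respect to this same operator $A_2$: there is a functional $H$ with $(V^i_\mu)_x=A_2^{ij}\frac{\delta H}{\delta u^j}$. Here $H=\int h\,dx$ may be nonlocal: $h$ is a function of $x$, of potentials $b^i$ with $b^i_x=u^i$, and of the $x$-derivatives of the $b^i$, and $D_x\frac{\delta H}{\delta u^j}=-\frac{\delta H}{\delta b^j}$. 4. These systems come from the WDVV equations. Let $F$ be of class $C^4$ on an open set $M\subseteq\mathbb R^N$ with $F_{1\alpha\beta}=\eta_{\alpha\beta}$,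 and let $\mu$ be as in 3. On $M$, $S_{p\beta\mu\nu}=\psi^\gamma_k(u_p)u^k_\mu-Z^\gamma_\mu(u_p)$ for all $\gamma=(\nu,\beta+1)$. Hence, at each point of $M$ where $\det\psi(u_p)\ne0$, the equations $S_{p\beta\mu\nu}=0$ (all $\beta,\nu$) hold if and only if $u_\mu=V_\mu(u_p)$. If they hold on all of $M$, then $(u^I_p)_\mu=(V^I_\mu(u_p))_p$ for all $I$ at each point of $M$ where $\det\psi(u_p)\neq0$. -/

import Mathlib

open scoped Matrix

noncomputable section

/-! ### Differential functions on the jet space of curves `x ↦ (uⁱ(x))` -/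

/-- Polynomials in `x` (the variable `none`) and the jet coordinates `uⁱ_k` (the variable
`some (i, k)`), where `uⁱ_k` stands for the `k`-th `x`-derivative of `uⁱ`. -/
abbrev JetPoly (σ : Type) : Type := MvPolynomial (Option (σ × ℕ)) ℝ

/-- Differential functions: rational functions of `x` and of finitely many jet coordinates. -/
abbrev DiffFun (σ : Type) : Type := FractionRing (JetPoly σ)

/-- Quotient rule, for a derivation from a domain to its fraction field. -/
def fracDerivFun {σ : Type} (d : Derivation ℝ (JetPoly σ) (DiffFun σ)) (F : DiffFun σ) :
    DiffFun σ :=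
  let a := (IsLocalization.sec (nonZeroDivisors (JetPoly σ)) F).1
  let b := ((IsLocalization.sec (nonZeroDivisors (JetPoly σ)) F).2 : JetPoly σ)
  (algebraMap (JetPoly σ) (DiffFun σ) b * d a - algebraMap (JetPoly σ) (DiffFun σ) a * d b) /
    algebraMap (JetPoly σ) (DiffFun σ) b ^ 2

theorem fracDerivFun_eq {σ : Type} (d : Derivation ℝ (JetPoly σ) (DiffFun σ))
    (F : DiffFun σ) (a b : JetPoly σ) (hb : b ≠ 0)
    (h : F * algebraMap (JetPoly σ) (DiffFun σ) b = algebraMap (JetPoly σ) (DiffFun σ) a) :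
    fracDerivFun d F =
      (algebraMap (JetPoly σ) (DiffFun σ) b * d a - algebraMap (JetPoly σ) (DiffFun σ) a * d b) /
        algebraMap (JetPoly σ) (DiffFun σ) b ^ 2 := by
  have h1 := IsLocalization.sec_spec (nonZeroDivisors (JetPoly σ)) F
  have hb1 := nonZeroDivisors.ne_zero
    (IsLocalization.sec (nonZeroDivisors (JetPoly σ)) F).2.2
  unfold fracDerivFun
  set a' := (IsLocalization.sec (nonZeroDivisors (JetPoly σ)) F).1
  set b' := ((IsLocalization.sec (nonZeroDivisors (JetPoly σ)) F).2 : JetPoly σ)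
  have inj := IsFractionRing.injective (JetPoly σ) (DiffFun σ)
  have hb0 : algebraMap (JetPoly σ) (DiffFun σ) b ≠ 0 := by
    simpa using (map_ne_zero_iff _ inj).2 hb
  have hb'0 : algebraMap (JetPoly σ) (DiffFun σ) b' ≠ 0 := by
    simpa using (map_ne_zero_iff _ inj).2 hb1
  have key : a' * b = a * b' := by
    apply inj
    rw [map_mul, map_mul, ← h, ← h1]
    ring
  have kd := congrArg d key
  have key' := congrArg (algebraMap (JetPoly σ) (DiffFun σ)) key
  simp only [Derivation.leibniz, Algebra.smul_def] at kd
  rw [map_mul, map_mul] at key'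
  rw [div_eq_div_iff (pow_ne_zero 2 hb'0) (pow_ne_zero 2 hb0)]
  set A := algebraMap (JetPoly σ) (DiffFun σ) a
  set B := algebraMap (JetPoly σ) (DiffFun σ) b
  set A' := algebraMap (JetPoly σ) (DiffFun σ) a'
  set B' := algebraMap (JetPoly σ) (DiffFun σ) b'
  linear_combination (B * B') * kd - (B' * d b + B * d b') * key'

theorem exists_fraction {σ : Type} (F : DiffFun σ) : ∃ a b : JetPoly σ, b ≠ 0 ∧
    F * algebraMap (JetPoly σ) (DiffFun σ) b = algebraMap (JetPoly σ) (DiffFun σ) a :=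
  ⟨_, _, nonZeroDivisors.ne_zero (IsLocalization.sec (nonZeroDivisors (JetPoly σ)) F).2.2,
    IsLocalization.sec_spec (nonZeroDivisors (JetPoly σ)) F⟩

theorem jetPoly_map_ne_zero {σ : Type} {b : JetPoly σ} (hb : b ≠ 0) :
    algebraMap (JetPoly σ) (DiffFun σ) b ≠ 0 := by
  simpa using (map_ne_zero_iff _ (IsFractionRing.injective (JetPoly σ) (DiffFun σ))).2 hb

theorem fracDerivFun_algebraMap {σ : Type} (d : Derivation ℝ (JetPoly σ) (DiffFun σ))
    (a : JetPoly σ) : fracDerivFun d (algebraMap (JetPoly σ) (DiffFun σ) a) = d a := by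
  rw [fracDerivFun_eq d _ a 1 one_ne_zero (by simp)]
  simp

theorem fracDerivFun_add {σ : Type} (d : Derivation ℝ (JetPoly σ) (DiffFun σ))
    (F G : DiffFun σ) : fracDerivFun d (F + G) = fracDerivFun d F + fracDerivFun d G := by
  obtain ⟨a, b, hb, h⟩ := exists_fraction F
  obtain ⟨a', b', hb', h'⟩ := exists_fraction G
  have h0 := jetPoly_map_ne_zero hb
  have h0' := jetPoly_map_ne_zero hb'
  rw [fracDerivFun_eq d F a b hb h, fracDerivFun_eq d G a' b' hb' h',
    fracDerivFun_eq d (F + G) (a * b' + a' * b) (b * b') (mul_ne_zero hb hb') (by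
      rw [map_mul, map_add, map_mul, map_mul, ← h, ← h']; ring)]
  simp only [d.leibniz, d.map_add, RingHom.map_mul, RingHom.map_add, Algebra.smul_def]
  generalize algebraMap (JetPoly σ) (DiffFun σ) a = A
  generalize algebraMap (JetPoly σ) (DiffFun σ) a' = A'
  generalize algebraMap (JetPoly σ) (DiffFun σ) b = B at h0 ⊢
  generalize algebraMap (JetPoly σ) (DiffFun σ) b' = B' at h0' ⊢
  generalize d a = x
  generalize d a' = x'
  generalize d b = y
  generalize d b' = y'
  rw [div_add_div _ _ (pow_ne_zero 2 h0) (pow_ne_zero 2 h0'),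
    div_eq_div_iff (pow_ne_zero 2 (mul_ne_zero h0 h0'))
      (mul_ne_zero (pow_ne_zero 2 h0) (pow_ne_zero 2 h0'))]
  ring

theorem fracDerivFun_mul {σ : Type} (d : Derivation ℝ (JetPoly σ) (DiffFun σ))
    (F G : DiffFun σ) :
    fracDerivFun d (F * G) = F * fracDerivFun d G + G * fracDerivFun d F := by
  obtain ⟨a, b, hb, h⟩ := exists_fraction F
  obtain ⟨a', b', hb', h'⟩ := exists_fraction G
  have h0 := jetPoly_map_ne_zero hb
  have h0' := jetPoly_map_ne_zero hb'
  rw [fracDerivFun_eq d F a b hb h, fracDerivFun_eq d G a' b' hb' h',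
    fracDerivFun_eq d (F * G) (a * a') (b * b') (mul_ne_zero hb hb') (by
      rw [map_mul, map_mul, ← h, ← h']; ring)]
  simp only [d.leibniz, RingHom.map_mul, Algebra.smul_def]
  rw [← h, ← h']
  generalize algebraMap (JetPoly σ) (DiffFun σ) b = B at h0 ⊢
  generalize algebraMap (JetPoly σ) (DiffFun σ) b' = B' at h0' ⊢
  generalize d a = x
  generalize d a' = x'
  generalize d b = y
  generalize d b' = y'
  rw [mul_div_assoc', mul_div_assoc',
    div_add_div _ _ (pow_ne_zero 2 h0') (pow_ne_zero 2 h0),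
    div_eq_div_iff (pow_ne_zero 2 (mul_ne_zero h0 h0'))
      (mul_ne_zero (pow_ne_zero 2 h0') (pow_ne_zero 2 h0))]
  ring

theorem fracDerivFun_smul {σ : Type} (d : Derivation ℝ (JetPoly σ) (DiffFun σ))
    (r : ℝ) (F : DiffFun σ) : fracDerivFun d (r • F) = r • fracDerivFun d F := by
  obtain ⟨a, b, hb, h⟩ := exists_fraction F
  have e : algebraMap (JetPoly σ) (DiffFun σ) (r • a) =
      r • algebraMap (JetPoly σ) (DiffFun σ) a :=
    map_smul (IsScalarTower.toAlgHom ℝ (JetPoly σ) (DiffFun σ)) r a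
  rw [fracDerivFun_eq d F a b hb h,
    fracDerivFun_eq d (r • F) (r • a) b hb (by rw [smul_mul_assoc, h, e]), e, d.map_smul,
    mul_smul_comm, smul_mul_assoc, ← smul_sub, smul_div_assoc]

/-- The unique extension to differential functions of a derivation defined on polynomials. -/
def fracDeriv {σ : Type} (d : Derivation ℝ (JetPoly σ) (DiffFun σ)) :
    Derivation ℝ (DiffFun σ) (DiffFun σ) :=
  Derivation.mk'
    { toFun := fracDerivFun d
      map_add' := fracDerivFun_add d
      map_smul' := fracDerivFun_smul d }
    (fracDerivFun_mul d)

theorem fracDeriv_algebraMap {σ : Type} (d : Derivation ℝ (JetPoly σ) (DiffFun σ))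
    (a : JetPoly σ) : fracDeriv d (algebraMap (JetPoly σ) (DiffFun σ) a) = d a :=
  fracDerivFun_algebraMap d a

/-- The independent variable `x`. -/
def jetX {σ : Type} : DiffFun σ := algebraMap (JetPoly σ) (DiffFun σ) (MvPolynomial.X none)

/-- The jet coordinate `uⁱ_k`; in particular `jetU i 0` is the field variable `uⁱ`. -/
def jetU {σ : Type} (i : σ) (k : ℕ) : DiffFun σ :=
  algebraMap (JetPoly σ) (DiffFun σ) (MvPolynomial.X (some (i, k)))

/-- Partial derivative `∂/∂uⁱ_k`. -/
def jetPartial {σ : Type} [DecidableEq σ] (i : σ) (k : ℕ) :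
    Derivation ℝ (DiffFun σ) (DiffFun σ) :=
  fracDeriv (MvPolynomial.mkDerivation ℝ (fun v => if v = some (i, k) then 1 else 0))

/-- Total derivative `D_x = ∂/∂x + ∑ uⁱ_{k+1} ∂/∂uⁱ_k`. -/
def totalD {σ : Type} : Derivation ℝ (DiffFun σ) (DiffFun σ) :=
  fracDeriv (MvPolynomial.mkDerivation ℝ (fun v => v.elim 1 (fun q => jetU q.1 (q.2 + 1))))

theorem jetPartial_jetU {σ : Type} [DecidableEq σ] (i j : σ) (k l : ℕ) :
    jetPartial i k (jetU j l) = if j = i ∧ l = k then 1 else 0 := by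
  rw [jetPartial, jetU, fracDeriv_algebraMap, MvPolynomial.mkDerivation_X]
  simp

theorem jetPartial_jetX {σ : Type} [DecidableEq σ] (i : σ) (k : ℕ) :
    jetPartial i k (jetX : DiffFun σ) = 0 := by
  rw [jetPartial, jetX, fracDeriv_algebraMap, MvPolynomial.mkDerivation_X]
  simp

theorem totalD_jetU {σ : Type} (i : σ) (k : ℕ) : totalD (jetU i k) = jetU i (k + 1) := by
  rw [totalD, jetU, fracDeriv_algebraMap, MvPolynomial.mkDerivation_X]
  simp

theorem totalD_jetX {σ : Type} : totalD (jetX : DiffFun σ) = 1 := by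
  rw [totalD, jetX, fracDeriv_algebraMap, MvPolynomial.mkDerivation_X]
  simp

theorem finite_jetPartial {σ : Type} [DecidableEq σ] (i : σ) (F : DiffFun σ) :
    {k : ℕ | jetPartial i k F ≠ 0}.Finite := by
  obtain ⟨a, b, hb, h⟩ := exists_fraction F
  have hp : ∀ (c : JetPoly σ) (k : ℕ), some (i, k) ∉ c.vars →
      MvPolynomial.mkDerivation ℝ
        (fun v => if v = some (i, k) then (1 : DiffFun σ) else 0) c = 0 := by
    intro c k hk
    apply MvPolynomial.derivation_eq_zero_of_forall_mem_vars
    intro v hv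
    rw [MvPolynomial.mkDerivation_X, if_neg]
    rintro rfl
    exact hk hv
  have hs : Function.Injective (fun k : ℕ => (some (i, k) : Option (σ × ℕ))) := by
    intro k l hkl
    simpa using hkl
  refine (((a.vars ∪ b.vars).finite_toSet).preimage hs.injOn).subset ?_
  intro k hk
  by_contra hn
  simp only [Set.mem_preimage, Finset.coe_union, Set.mem_union, Finset.mem_coe, not_or] at hn
  apply hk
  change fracDerivFun _ F = 0
  rw [fracDerivFun_eq _ F a b hb h, hp a k hn.1, hp b k hn.2]
  simp

/-- Variational derivative `δF/δuⁱ = ∑_k (-D_x)^k (∂F/∂uⁱ_k)` of the functional with density `F`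
(a finite sum by `finite_jetPartial`). -/
def varDeriv {σ : Type} [DecidableEq σ] (i : σ) (F : DiffFun σ) : DiffFun σ :=
  ∑ᶠ k : ℕ, (-1 : DiffFun σ) ^ k * (fun G => totalD G)^[k] (jetPartial i k F)

/-! ### Hamiltonian operators and Hamiltonian systems -/

/-- Density of `{F, G}_A = ∫ (δF/δuⁱ) Aⁱʲ (δG/δuʲ) dx`. -/
def bracketDensity {σ : Type} [Fintype σ] [DecidableEq σ]
    (A : (σ → DiffFun σ) → (σ → DiffFun σ)) (F G : DiffFun σ) : DiffFun σ :=
  ∑ i, varDeriv i F * A (fun j => varDeriv j G) i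

/-- A matrix differential operator is Hamiltonian if it is formally skew-adjoint and its bracket
of functionals satisfies the Jacobi identity; both hold modulo total derivatives, because
`∫ D_x w dx = 0`. -/
def IsHamiltonianOperator {σ : Type} [Fintype σ] [DecidableEq σ]
    (A : (σ → DiffFun σ) → (σ → DiffFun σ)) : Prop :=
  (∀ a b : σ → DiffFun σ, ∃ w : DiffFun σ, ∑ i, (a i * A b i + b i * A a i) = totalD w) ∧
  (∀ F G H : DiffFun σ, ∃ w : DiffFun σ,
    bracketDensity A (bracketDensity A F G) H + bracketDensity A (bracketDensity A G H) F
      + bracketDensity A (bracketDensity A H F) G = totalD w)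

/-- The matrix of coefficients `cⁱʲ_k u^k_x`, where `c_{ijk} = f_{iq} f_{jp} c^{pq}_k` and
`c_{skm} = (f_{sm,k} - f_{sk,m}) / 3`. -/
def dpConnection {σ : Type} [Fintype σ] [DecidableEq σ] (f : Matrix σ σ (DiffFun σ)) :
    Matrix σ σ (DiffFun σ) :=
  Matrix.of fun p q => ∑ k, (∑ i, ∑ j, f⁻¹ q i * f⁻¹ p j *
    ((1 / 3 : DiffFun σ) * (jetPartial j 0 (f i k) - jetPartial k 0 (f i j)))) * jetU k 1

/-- The first-order operator `P D_x + Q`. -/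
def firstOrderOp {σ : Type} [Fintype σ] (P Q : Matrix σ σ (DiffFun σ))
    (a : σ → DiffFun σ) : σ → DiffFun σ :=
  fun i => ∑ j, (P i j * totalD (a j) + Q i j * a j)

/-- The Doyle--Potëmin operator `D_x ∘ (fⁱʲ D_x + cⁱʲ_k u^k_x) ∘ D_x` with leading coefficient
the inverse of `f = (f_{ij})`. -/
def doylePotemin {σ : Type} [Fintype σ] [DecidableEq σ] (f : Matrix σ σ (DiffFun σ))
    (a : σ → DiffFun σ) : σ → DiffFun σ :=
  fun i => totalD (firstOrderOp f⁻¹ (dpConnection f) (fun j => totalD (a j)) i)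

/-- A Monge metric: a nondegenerate symmetric `f` with `f_{mk,s} + f_{ks,m} + f_{ms,k} = 0`. -/
def IsMongeMetric {σ : Type} [Fintype σ] [DecidableEq σ] (f : Matrix σ σ (DiffFun σ)) : Prop :=
  f.IsSymm ∧ f.det ≠ 0 ∧ ∀ m k s : σ,
    jetPartial s 0 (f m k) + jetPartial m 0 (f k s) + jetPartial k 0 (f m s) = 0

/-- Shift of jet coordinates, `x ↦ x`, `uⁱ_k ↦ uⁱ_{k+1}`, on polynomials. -/
def jetShift {σ : Type} : JetPoly σ →ₐ[ℝ] JetPoly σ :=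
  MvPolynomial.rename (Option.map (fun q => (q.1, q.2 + 1)))

theorem jetShift_injective {σ : Type} :
    Function.Injective ((algebraMap (JetPoly σ) (DiffFun σ)).comp
      (jetShift (σ := σ) : JetPoly σ →+* JetPoly σ)) := by
  refine (IsFractionRing.injective (JetPoly σ) (DiffFun σ)).comp
    (MvPolynomial.rename_injective _ (Option.map_injective ?_))
  rintro ⟨a, k⟩ ⟨b, l⟩ h
  simpa using h

/-- Passage to potentials. In the target the jet coordinates `jetU i k` are read as the
`x`-derivatives `bⁱ_k` of potentials `bⁱ`; a differential function of `u` is sent to the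
differential function of `b` obtained by substituting `uⁱ = bⁱ_x`. -/
def toPotentials {σ : Type} : DiffFun σ →+* DiffFun σ :=
  IsFractionRing.lift (jetShift_injective (σ := σ))

theorem toPotentials_jetU {σ : Type} (i : σ) (k : ℕ) :
    toPotentials (jetU i k) = jetU i (k + 1) := by
  unfold toPotentials jetU
  rw [IsFractionRing.lift_algebraMap]
  simp [jetShift]

/-- The system of conservation laws `uⁱ_t = (Vⁱ)_x` is Hamiltonian with respect to the
Doyle--Potëmin operator `A` of `f`: there is a functional `H` with `(Vⁱ)_x = Aⁱʲ (δH/δuʲ)`.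
As always for these operators, `H = ∫ h dx` may be nonlocal in `u`: its density `h` is a
differential function of the potentials `bⁱ`, `uⁱ = bⁱ_x`. By the chain rule
`D_x (δH/δuʲ) = - δH/δbʲ`, so that
`Aⁱʲ (δH/δuʲ) = D_x ((fⁱʲ D_x + cⁱʲ_k u^k_x) (- δH/δbʲ))`. -/
def IsHamiltonianSystem {σ : Type} [Fintype σ] [DecidableEq σ] (f : Matrix σ σ (DiffFun σ))
    (V : σ → DiffFun σ) : Prop :=
  ∃ h : DiffFun σ, ∀ i : σ, toPotentials (totalD (V i)) =
    totalD (firstOrderOp (f⁻¹.map toPotentials) ((dpConnection f).map toPotentials)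
      (fun j => - varDeriv j h) i)

/-! ### The WDVV data

The indices `1, …, N` are represented by the elements `0, …, N - 1` of `Fin N`. -/

/-- Index pairs `(m, i)` with `2 ≤ i ≤ m ≤ N`. There are `n = N (N - 1) / 2` of them. -/
abbrev WIdx (N : ℕ) [NeZero N] : Type := {q : Fin N × Fin N // 0 < q.2 ∧ q.2 ≤ q.1}

/-- For `γ = (ν, β + 1)`, the index `ν`. -/
def WIdx.nu {N : ℕ} [NeZero N] (γ : WIdx N) : Fin N := γ.1.1

/-- For `γ = (ν, β + 1)`, the index `β` (so `1 ≤ β < ν ≤ N`). -/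
def WIdx.beta {N : ℕ} [NeZero N] (γ : WIdx N) : Fin N :=
  ⟨γ.1.2.val - 1, lt_of_le_of_lt (Nat.sub_le _ _) γ.1.2.isLt⟩

/-- Equal to `1` if `k` is the index pair `(a, b) = (b, a)`, and to `0` otherwise; in particular
it is `0` if `a` or `b` is the first index. -/
def pairDelta {N : ℕ} [NeZero N] (k : WIdx N) (a b : Fin N) : ℝ :=
  if k.1 = (max a b, min a b) then 1 else 0

/-- `ψ^γ_{km}`, skew-symmetric in `k, m`: for `γ = (ν, β + 1)` with `β ≥ 2` it is `η^{ab}` at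
`k = (ν, a)`, `m = (β, b)`, unless `k = m`; it vanishes for `β = 1`. -/
def psiTwo {N : ℕ} [NeZero N] (η : Matrix (Fin N) (Fin N) ℝ) (γ k m : WIdx N) : ℝ :=
  ∑ a, ∑ b, η⁻¹ a b * (pairDelta k γ.nu a * pairDelta m γ.beta b
    - pairDelta k γ.beta b * pairDelta m γ.nu a)

/-- `_ρω^γ_k`. -/
def omegaCoeff {N : ℕ} [NeZero N] (η : Matrix (Fin N) (Fin N) ℝ) (ρ : Fin N) (γ k : WIdx N) : ℝ :=
  if γ.beta = 0 then pairDelta k γ.nu ρ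
  else ∑ a, η⁻¹ 0 a * (η ρ γ.beta * pairDelta k γ.nu a - η ρ γ.nu * pairDelta k γ.beta a)

/-- `_{λμ}ξ^γ`. -/
def xiCoeff {N : ℕ} [NeZero N] (η : Matrix (Fin N) (Fin N) ℝ) (l μ : Fin N) (γ : WIdx N) : ℝ :=
  if γ.beta = 0 then 0
  else - η⁻¹ 0 0 * (η l γ.beta * η μ γ.nu - η l γ.nu * η μ γ.beta)

/-- `φ_{(A,a)(B,b)} = η^{AB} η^{(a-1)(b-1)} - η^{A(b-1)} η^{B(a-1)}`. -/
def phiCoeff {N : ℕ} [NeZero N] (η : Matrix (Fin N) (Fin N) ℝ) (γ δ : WIdx N) : ℝ :=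
  η⁻¹ γ.nu δ.nu * η⁻¹ γ.beta δ.beta - η⁻¹ γ.nu δ.beta * η⁻¹ δ.nu γ.beta

/-- The matrix `ψ^γ_k = ψ^γ_{km} u^m + _pω^γ_k`; rows are indexed by `γ`. -/
def psiMat {N : ℕ} [NeZero N] {R : Type} [Field R] [Algebra ℝ R]
    (η : Matrix (Fin N) (Fin N) ℝ) (p : Fin N) (u : WIdx N → R) : Matrix (WIdx N) (WIdx N) R :=
  Matrix.of fun γ k => ∑ m, algebraMap ℝ R (psiTwo η γ k m) * u m
    + algebraMap ℝ R (omegaCoeff η p γ k)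

/-- `Z^γ_μ = _μω^γ_k u^k + _{pμ}ξ^γ`. -/
def zVec {N : ℕ} [NeZero N] {R : Type} [Field R] [Algebra ℝ R]
    (η : Matrix (Fin N) (Fin N) ℝ) (p μ : Fin N) (u : WIdx N → R) : WIdx N → R :=
  fun γ => ∑ k, algebraMap ℝ R (omegaCoeff η μ γ k) * u k + algebraMap ℝ R (xiCoeff η p μ γ)

/-- The fluxes `V_μ = ψ⁻¹ Z_μ`, as functions of the field variables `u = u_p`. -/
def flux {N : ℕ} [NeZero N] {R : Type} [Field R] [Algebra ℝ R]
    (η : Matrix (Fin N) (Fin N) ℝ) (p μ : Fin N) (u : WIdx N → R) : WIdx N → R :=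
  (psiMat η p u)⁻¹ *ᵥ zVec η p μ u

/-- The metric `f_{ij} = φ_{αβ} ψ^α_i ψ^β_j` in the field variables `u^I = jetU I 0`. -/
def wdvvMetric {N : ℕ} [NeZero N] (η : Matrix (Fin N) (Fin N) ℝ) (p : Fin N) :
    Matrix (WIdx N) (WIdx N) (DiffFun (WIdx N)) :=
  Matrix.of fun i j => ∑ α, ∑ β, algebraMap ℝ (DiffFun (WIdx N)) (phiCoeff η α β) *
    psiMat η p (fun I => jetU I 0) α i * psiMat η p (fun I => jetU I 0) β j

/-- Partial derivative `∂/∂t^i`. -/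
def tPartial {N : ℕ} (i : Fin N) (G : (Fin N → ℝ) → ℝ) (t : Fin N → ℝ) : ℝ :=
  fderiv ℝ G t (Pi.single i 1)

/-- `F_{αβγ}`. -/
def third {N : ℕ} (F : (Fin N → ℝ) → ℝ) (α β γ : Fin N) : (Fin N → ℝ) → ℝ :=
  tPartial α (tPartial β (tPartial γ F))

/-- `S_{αβγν} = η^{λμ} (F_{λαβ} F_{μγν} - F_{λαν} F_{μγβ})`. -/
def wdvvS {N : ℕ} (η : Matrix (Fin N) (Fin N) ℝ) (F : (Fin N → ℝ) → ℝ)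
    (α β γ ν : Fin N) (t : Fin N → ℝ) : ℝ :=
  ∑ l, ∑ m, η⁻¹ l m * (third F l α β t * third F m γ ν t - third F l α ν t * third F m γ β t)

/-- `u^I_λ = F_{λ i m}` for `I = (m, i)`. -/
def uField {N : ℕ} [NeZero N] (F : (Fin N → ℝ) → ℝ) (l : Fin N) (t : Fin N → ℝ) : WIdx N → ℝ :=
  fun I => third F l I.1.2 I.1.1 t

end

/-! Everything becomes linear algebra of symmetric matrices. Put `h = η⁻¹` and `[X, Y] = X h Y - Y h
X`, a skew matrix for symmetric `X, Y`. The index `γ` runs over the entries above the diagonal of a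
skew matrix, the index `k` over a basis `E_k` of the symmetric matrices with vanishing first row.
With `B_ρ` the symmetric matrix that carries only the first row `η_ρ`, the constants `ψ`, `ω`, `ξ`
are entries of `[E_m, E_k]`, `[B_ρ, E_k]` and `[B_μ, B_l]`. For `U_ρ = ∑ u^k_ρ E_k + B_ρ =
(F_{ρab})` the WDVV expression is therefore an entry of `[U_p, U_μ]`; splitting off `B_μ` gives `ψ
u_μ - Z_μ` (`psiMat_mulVec_sub_zVec`).

The form `φ` is `-1/2 tr(X h Y h)` on skew matrices. Invariance of the trace and the Jacobi identity
for commutators of the `X h` give the Bianchi identity `φ([a,b],[c,d]) + φ([a,c],[d,b]) +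
φ([a,d],[b,c]) = 0` (`bracketForm_bianchi`). All algebraic conditions below are instances of it.

Generic invertibility of `ψ`: a kernel vector is a symmetric `V` with `U h V = V h U` and `V e = 0`,
where `e` is the first basis vector. If `e` is cyclic for `h U`, then `V = 0`. A suitable `U` with
the prescribed first column is built by rank-one perturbations (`exists_cyclic`).

For `f = Ψᵀ φ Ψ` with `Ψ` affine in `u`, the Doyle--Potëmin operator factors as `D Ψ⁻¹ φ⁻¹ D Ψ⁻ᵀ D`
(`doylePotemin_apply`). Skew-adjointness is then integration by parts. In the Jacobi identity the
second variations cancel by symmetry, and the variation of the operator leaves a total derivative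
plus a cyclic sum that vanishes by Bianchi. For the systems, `Z_μ` is `D ζ` in the potentials, so
the covector `Ψᵀ φ ζ` is sent to the required flow; Bianchi makes it a variational derivative. -/

set_option linter.unusedSectionVars false

/-! ### Differential algebra on the jet space -/

section JetCalculus

variable {σ : Type}

/-- Two derivations along a ring homomorphism that agree on `x` and on the jet coordinates are
equal. -/
theorem leibniz_ext (T : DiffFun σ →+* DiffFun σ) (d₁ d₂ : DiffFun σ →+ DiffFun σ)
    (h₁ : ∀ a b, d₁ (a * b) = T a * d₁ b + T b * d₁ a)
    (h₂ : ∀ a b, d₂ (a * b) = T a * d₂ b + T b * d₂ a)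
    (hc : ∀ r : ℝ, d₁ (algebraMap ℝ _ r) = d₂ (algebraMap ℝ _ r))
    (hx : d₁ jetX = d₂ jetX) (hu : ∀ i k, d₁ (jetU i k) = d₂ (jetU i k)) (F : DiffFun σ) :
    d₁ F = d₂ F := by
  have hp : ∀ a : JetPoly σ, d₁ (algebraMap _ _ a) = d₂ (algebraMap _ _ a) := by
    intro a
    induction a using MvPolynomial.induction_on with
    | C r =>
      have := IsScalarTower.algebraMap_apply ℝ (JetPoly σ) (DiffFun σ) r
      rw [MvPolynomial.algebraMap_eq] at this
      rw [← this, hc]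
    | add a b ha hb => rw [map_add, map_add, map_add, ha, hb]
    | mul_X a v ha =>
      rw [map_mul, h₁, h₂, ha]
      rcases v with _ | ⟨i, k⟩
      · exact congrArg (fun z => T _ * z + _) hx
      · exact congrArg (fun z => T _ * z + _) (hu i k)
  obtain ⟨a, b, hb, h⟩ := exists_fraction F
  have hb0 : T (algebraMap _ _ b) ≠ 0 := (map_ne_zero T).2 (jetPoly_map_ne_zero hb)
  have e₁ := h₁ F (algebraMap _ _ b)
  have e₂ := h₂ F (algebraMap _ _ b)
  rw [h, hp] at e₁
  rw [h] at e₂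
  rw [hp] at e₁
  apply mul_left_cancel₀ hb0
  linear_combination e₂ - e₁

theorem diffFun_derivation_ext {d₁ d₂ : Derivation ℝ (DiffFun σ) (DiffFun σ)}
    (hx : d₁ jetX = d₂ jetX) (hu : ∀ i k, d₁ (jetU i k) = d₂ (jetU i k)) : d₁ = d₂ := by
  ext F
  exact leibniz_ext (RingHom.id _) (d₁ : DiffFun σ →ₗ[ℝ] DiffFun σ).toAddMonoidHom
    (d₂ : DiffFun σ →ₗ[ℝ] DiffFun σ).toAddMonoidHom (fun a b => by simp) (fun a b => by simp)
    (fun r => by simp) hx hu F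

theorem toPotentials_algebraMap_real (r : ℝ) :
    toPotentials (algebraMap ℝ (DiffFun σ) r) = algebraMap ℝ (DiffFun σ) r := by
  rw [IsScalarTower.algebraMap_apply ℝ (JetPoly σ) (DiffFun σ)]
  unfold toPotentials
  rw [IsFractionRing.lift_algebraMap]
  simp

theorem toPotentials_jetX : toPotentials (jetX : DiffFun σ) = jetX := by
  unfold toPotentials jetX
  rw [IsFractionRing.lift_algebraMap]
  simp [jetShift]

theorem toPotentials_totalD (F : DiffFun σ) :
    toPotentials (totalD F) = totalD (toPotentials F) := by
  refine leibniz_ext toPotentials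
    ((toPotentials (σ := σ) : DiffFun σ →+ DiffFun σ).comp
      ((totalD (σ := σ)).toLinearMap : DiffFun σ →+ DiffFun σ))
    (((totalD (σ := σ)).toLinearMap : DiffFun σ →+ DiffFun σ).comp
      (toPotentials (σ := σ) : DiffFun σ →+ DiffFun σ))
    (fun a b => ?_) (fun a b => ?_) (fun r => ?_) ?_ (fun i k => ?_) F
  · simp
  · simp
  · simp [toPotentials_algebraMap_real]
  · simp [toPotentials_jetX, totalD_jetX]
  · simp [toPotentials_jetU, totalD_jetU]

/-- The evolutionary derivation with characteristic `Q`: it commutes with `D_x` and sends `uⁱ`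
to `Qⁱ`. -/
noncomputable def evolution (Q : σ → DiffFun σ) : Derivation ℝ (DiffFun σ) (DiffFun σ) :=
  fracDeriv (MvPolynomial.mkDerivation ℝ
    (fun v => v.elim 0 (fun q => (fun G => totalD G)^[q.2] (Q q.1))))

theorem evolution_jetX (Q : σ → DiffFun σ) : evolution Q jetX = 0 := by
  rw [evolution, jetX, fracDeriv_algebraMap, MvPolynomial.mkDerivation_X]
  rfl

theorem evolution_jetU (Q : σ → DiffFun σ) (i : σ) (k : ℕ) :
    evolution Q (jetU i k) = (fun G => totalD G)^[k] (Q i) := by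
  rw [evolution, jetU, fracDeriv_algebraMap, MvPolynomial.mkDerivation_X]
  rfl

/-- The commutator is again a derivation, so it is enough that it kills `x` and the jet coordinates.
-/
theorem evolution_totalD (Q : σ → DiffFun σ) (F : DiffFun σ) :
    evolution Q (totalD F) = totalD (evolution Q F) := by
  have h : ⁅evolution Q, (totalD : Derivation ℝ (DiffFun σ) (DiffFun σ))⁆ = 0 := by
    apply diffFun_derivation_ext
    · simp [Derivation.commutator_apply, totalD_jetX, evolution_jetX]
    · intro i k
      simp [Derivation.commutator_apply, totalD_jetU, evolution_jetU,
        Function.iterate_succ_apply']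
  have := congrArg (fun d => d F) h
  simpa [Derivation.commutator_apply, sub_eq_zero] using this

theorem evolution_iterate_totalD (Q : σ → DiffFun σ) (k : ℕ) (F : DiffFun σ) :
    evolution Q ((fun G => totalD G)^[k] F) = (fun G => totalD G)^[k] (evolution Q F) := by
  induction k generalizing F with
  | zero => rfl
  | succ k ih => rw [Function.iterate_succ_apply, Function.iterate_succ_apply, ih,
      evolution_totalD]

theorem evolution_commutator (Q R : σ → DiffFun σ) (F : DiffFun σ) :
    evolution Q (evolution R F) - evolution R (evolution Q F) =
      evolution (fun i => evolution Q (R i) - evolution R (Q i)) F := by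
  have h : ⁅evolution Q, evolution R⁆ =
      evolution (fun i => evolution Q (R i) - evolution R (Q i)) := by
    apply diffFun_derivation_ext
    · simp [Derivation.commutator_apply, evolution_jetX]
    · intro i k
      rw [Derivation.commutator_apply, evolution_jetU, evolution_jetU, evolution_jetU,
        evolution_iterate_totalD, evolution_iterate_totalD]
      have hs : ∀ (a b : DiffFun σ), (fun G => totalD G)^[k] (a - b) =
          (fun G => totalD G)^[k] a - (fun G => totalD G)^[k] b := by
        intro a b
        exact iterate_map_sub (totalD : Derivation ℝ (DiffFun σ) (DiffFun σ)) k a b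
      exact (hs _ _).symm
  have := congrArg (fun d => d F) h
  simpa [Derivation.commutator_apply] using this

/-- The space of total derivatives. -/
noncomputable def totalDRange (σ : Type) : Submodule ℝ (DiffFun σ) :=
  LinearMap.range (totalD : Derivation ℝ (DiffFun σ) (DiffFun σ)).toLinearMap

theorem totalD_mem (F : DiffFun σ) : totalD F ∈ totalDRange σ := ⟨F, rfl⟩

theorem mem_totalDRange {F : DiffFun σ} : F ∈ totalDRange σ ↔ ∃ w, F = totalD w :=
  ⟨fun ⟨w, hw⟩ => ⟨w, hw.symm⟩, fun ⟨w, hw⟩ => ⟨w, hw.symm⟩⟩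

theorem evolution_mem {F : DiffFun σ} (Q : σ → DiffFun σ) (h : F ∈ totalDRange σ) :
    evolution Q F ∈ totalDRange σ := by
  obtain ⟨w, rfl⟩ := mem_totalDRange.1 h
  rw [evolution_totalD]
  exact totalD_mem _

/-- Integration by parts `k` times. -/
theorem iterate_totalD_mul_sub_mem (k : ℕ) (a b : DiffFun σ) :
    (fun G => totalD G)^[k] a * b - a * ((-1) ^ k * (fun G => totalD G)^[k] b) ∈
      totalDRange σ := by
  induction k generalizing a b with
  | zero => simp
  | succ k ih =>
    have h := (totalDRange σ).add_mem (ih (totalD a) b)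
      (totalD_mem (a * ((-1) ^ k * (fun G => totalD G)^[k] b)))
    convert h using 1
    rw [Function.iterate_succ_apply, Function.iterate_succ_apply']
    have h1 : totalD ((-1 : DiffFun σ) ^ k) = 0 := by
      rw [Derivation.leibniz_pow]
      simp
    simp only [Derivation.leibniz, smul_eq_mul, h1]
    ring

/-! ### Variational derivatives and the variation formulas -/

variable [DecidableEq σ]

theorem varDeriv_eq_sum (i : σ) (F : DiffFun σ) (s : Finset ℕ)
    (hs : ∀ k, jetPartial i k F ≠ 0 → k ∈ s) :
    varDeriv i F = ∑ k ∈ s, (-1 : DiffFun σ) ^ k * (fun G => totalD G)^[k] (jetPartial i k F) := by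
  apply finsum_eq_sum_of_support_subset
  intro k hk
  apply hs
  intro h
  apply hk
  have : (fun G : DiffFun σ => totalD G)^[k] 0 = 0 :=
    iterate_map_zero (totalD : Derivation ℝ (DiffFun σ) (DiffFun σ)) k
  change _ * _ = _
  rw [h, this, mul_zero]

variable [Fintype σ]

/-- The derivation `∑ D_x^k(Qⁱ) ∂/∂uⁱ_k`. -/
noncomputable def prolongation (Q : σ → DiffFun σ) : Derivation ℝ (DiffFun σ) (DiffFun σ) :=
  have hf : ∀ (i : σ) (F : DiffFun σ),
      (Function.support fun k => (fun G => totalD G)^[k] (Q i) * jetPartial i k F).Finite :=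
    fun i F => (finite_jetPartial i F).subset fun k hk h => hk (by simp [h])
  Derivation.mk'
    { toFun := fun F => ∑ i, ∑ᶠ k : ℕ, (fun G => totalD G)^[k] (Q i) * jetPartial i k F
      map_add' := fun F G => by
        rw [← Finset.sum_add_distrib]
        refine Finset.sum_congr rfl fun i _ => ?_
        rw [← finsum_add_distrib (hf i F) (hf i G)]
        simp only [map_add, mul_add]
      map_smul' := fun r F => by
        rw [RingHom.id_apply, Finset.smul_sum]
        refine Finset.sum_congr rfl fun i _ => ?_
        rw [smul_finsum]
        refine finsum_congr fun k => ?_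
        rw [Derivation.map_smul, mul_smul_comm] }
    fun F G => by
      simp only [LinearMap.coe_mk, AddHom.coe_mk, smul_eq_mul, Finset.mul_sum]
      rw [← Finset.sum_add_distrib]
      refine Finset.sum_congr rfl fun i _ => ?_
      rw [mul_finsum _ F, mul_finsum _ G, ← finsum_add_distrib]
      · refine finsum_congr fun k => ?_
        rw [Derivation.leibniz, smul_eq_mul, smul_eq_mul]
        ring
      · exact (hf i G).subset fun k hk h => hk (by simp only at h; simp [h])
      · exact (hf i F).subset fun k hk h => hk (by simp only at h; simp [h])

/-- `evolution` is suited to commutation with `D_x`, the explicit sum to integration by parts. Both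
are derivations with the same values on the generators. -/
theorem evolution_eq_prolongation (Q : σ → DiffFun σ) : evolution Q = prolongation Q := by
  apply diffFun_derivation_ext
  · rw [evolution_jetX]
    change _ = ∑ i, ∑ᶠ k : ℕ, (fun G => totalD G)^[k] (Q i) * jetPartial i k jetX
    simp [jetPartial_jetX]
  · intro j l
    rw [evolution_jetU]
    change _ = ∑ i, ∑ᶠ k : ℕ, (fun G => totalD G)^[k] (Q i) * jetPartial i k (jetU j l)
    rw [Finset.sum_eq_single j]
    · rw [finsum_eq_single _ l]
      · simp [jetPartial_jetU]
      · intro k hk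
        rw [jetPartial_jetU, if_neg (fun h => hk h.2.symm), mul_zero]
    · intro i _ hi
      simp [jetPartial_jetU, hi.symm]
    · simp

/-- First variation formula: `∫ X_Q(F) dx = ∫ Qⁱ δF/δuⁱ dx`. -/
theorem evolution_sub_varDeriv_mem (Q : σ → DiffFun σ) (F : DiffFun σ) :
    evolution Q F - ∑ i, varDeriv i F * Q i ∈ totalDRange σ := by
  rw [evolution_eq_prolongation]
  change (∑ i, ∑ᶠ k : ℕ, (fun G => totalD G)^[k] (Q i) * jetPartial i k F) - _ ∈ _
  rw [← Finset.sum_sub_distrib]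
  refine Submodule.sum_mem _ fun i _ => ?_
  rw [varDeriv_eq_sum i F (finite_jetPartial i F).toFinset (fun k hk => by simpa using hk),
    finsum_eq_sum_of_support_subset (s := (finite_jetPartial i F).toFinset) _
      (fun k hk => by
        simp only [Set.Finite.coe_toFinset, Set.mem_ofPred_eq]
        intro h
        exact hk (by simp [h])),
    Finset.sum_mul, ← Finset.sum_sub_distrib]
  refine Submodule.sum_mem _ fun k _ => ?_
  have := iterate_totalD_mul_sub_mem k (Q i) (jetPartial i k F)
  rwa [mul_comm (Q i)] at this

/-- The second variation of a functional is symmetric. -/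
theorem second_variation_symm_mem (Q R : σ → DiffFun σ) (F : DiffFun σ) :
    ∑ i, evolution Q (varDeriv i F) * R i - ∑ i, evolution R (varDeriv i F) * Q i ∈
      totalDRange σ := by
  -- Vary the first variation formula for `R` along `Q` and conversely, then subtract. The terms in
  -- which the characteristics themselves are varied are the first variation along the commutator,
  -- supplied by `h3`.
  have h1 := evolution_mem Q (evolution_sub_varDeriv_mem R F)
  have h2 := evolution_mem R (evolution_sub_varDeriv_mem Q F)
  have h3 := evolution_sub_varDeriv_mem (fun i => evolution Q (R i) - evolution R (Q i)) F
  rw [← evolution_commutator] at h3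
  have h := (totalDRange σ).add_mem ((totalDRange σ).sub_mem h2 h1) h3
  convert h using 1
  simp only [map_sub, map_sum, Derivation.leibniz, smul_eq_mul, mul_sub, Finset.sum_add_distrib,
    Finset.sum_sub_distrib]
  simp only [mul_comm]
  ring

end JetCalculus

/-! ### Monge metrics with a factorization `f = Ψᵀ φ Ψ` -/

section FactoredMetric

variable {σ : Type} [Fintype σ]

theorem derivation_dotProduct {K : Type*} [Field K] [Algebra ℝ K] (d : Derivation ℝ K K)
    (a b : σ → K) :
    d (a ⬝ᵥ b) = (fun i => d (a i)) ⬝ᵥ b + a ⬝ᵥ (fun i => d (b i)) := by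
  simp only [dotProduct, map_sum, Derivation.leibniz, smul_eq_mul, Finset.sum_add_distrib]
  rw [add_comm]
  simp only [mul_comm]

theorem derivation_mulVec {K : Type*} [Field K] [Algebra ℝ K] {τ : Type*} (d : Derivation ℝ K K)
    (A : Matrix τ σ K) (b : σ → K) :
    (fun i => d ((A *ᵥ b) i)) = A.map d *ᵥ b + A *ᵥ (fun i => d (b i)) := by
  funext i
  exact derivation_dotProduct d (A i) b

theorem map_derivation_algebraMap {K : Type*} [Field K] [Algebra ℝ K] {τ : Type*}
    (d : Derivation ℝ K K) (A : Matrix τ σ ℝ) : (A.map (algebraMap ℝ K)).map d = 0 := by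
  ext i j
  simp

theorem firstOrderOp_eq (P Q : Matrix σ σ (DiffFun σ)) (a : σ → DiffFun σ) :
    firstOrderOp P Q a = P *ᵥ (fun j => totalD (a j)) + Q *ᵥ a := by
  funext i
  simp [firstOrderOp, Matrix.mulVec, dotProduct, Finset.sum_add_distrib]

variable [DecidableEq σ]

/-- `Ψ` is an affine function of the field variables with linear part given by the constants
`c γ k m`, skew-symmetric in `k, m`, and `φ(Ψ_i, c_{jk}) + φ(Ψ_j, c_{ki}) + φ(Ψ_k, c_{ij}) = 0`. -/
structure IsMongeFactor (c : σ → σ → σ → ℝ) (φ : Matrix σ σ ℝ) (Ψ : Matrix σ σ (DiffFun σ)) :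
    Prop where
  skew : ∀ γ k m, c γ k m = - c γ m k
  symm : φ.IsSymm
  det_form : φ.det ≠ 0
  det_factor : Ψ.det ≠ 0
  deriv : ∀ (d : Derivation ℝ (DiffFun σ) (DiffFun σ)) (γ k : σ),
    d (Ψ γ k) = ∑ m, algebraMap ℝ _ (c γ k m) * d (jetU m 0)
  cyclic : ∀ i j k, ∑ γ, ∑ δ, algebraMap ℝ (DiffFun σ) (φ γ δ) *
    (Ψ γ i * algebraMap ℝ _ (c δ j k) + Ψ γ j * algebraMap ℝ _ (c δ k i)
      + Ψ γ k * algebraMap ℝ _ (c δ i j)) = 0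

/-- The quadratic form `φ` with coefficients in the differential functions. -/
noncomputable abbrev constForm (φ : Matrix σ σ ℝ) : Matrix σ σ (DiffFun σ) :=
  φ.map (algebraMap ℝ (DiffFun σ))

namespace IsMongeFactor

variable {c : σ → σ → σ → ℝ} {φ : Matrix σ σ ℝ} {Ψ : Matrix σ σ (DiffFun σ)}

theorem isUnit_det (h : IsMongeFactor c φ Ψ) : IsUnit Ψ.det := h.det_factor.isUnit

theorem isUnit_det_form (h : IsMongeFactor c φ Ψ) : IsUnit φ.det := h.det_form.isUnit

theorem constForm_mul_inv (h : IsMongeFactor c φ Ψ) : constForm φ * constForm φ⁻¹ = 1 := by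
  rw [← Matrix.map_mul, Matrix.mul_nonsing_inv _ h.isUnit_det_form]
  simp

theorem inv_mul_constForm (h : IsMongeFactor c φ Ψ) : constForm φ⁻¹ * constForm φ = 1 := by
  rw [← Matrix.map_mul, Matrix.nonsing_inv_mul _ h.isUnit_det_form]
  simp

theorem transpose_constForm (h : IsMongeFactor c φ Ψ) : (constForm φ)ᵀ = constForm φ := by
  rw [← Matrix.transpose_map, h.symm.eq]

theorem inv_metric (h : IsMongeFactor c φ Ψ) :
    (Ψᵀ * constForm φ * Ψ)⁻¹ = Ψ⁻¹ * constForm φ⁻¹ * Ψ⁻¹ᵀ := by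
  apply Matrix.inv_eq_right_inv
  calc Ψᵀ * constForm φ * Ψ * (Ψ⁻¹ * constForm φ⁻¹ * Ψ⁻¹ᵀ)
      = Ψᵀ * constForm φ * (Ψ * Ψ⁻¹) * constForm φ⁻¹ * Ψ⁻¹ᵀ := by simp only [Matrix.mul_assoc]
    _ = Ψᵀ * (constForm φ * constForm φ⁻¹) * Ψ⁻¹ᵀ := by
        rw [Matrix.mul_nonsing_inv _ h.isUnit_det, Matrix.mul_one]
        simp only [Matrix.mul_assoc]
    _ = 1 := by
        rw [h.constForm_mul_inv, Matrix.mul_one, ← Matrix.transpose_mul,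
          Matrix.nonsing_inv_mul _ h.isUnit_det, Matrix.transpose_one]

/-- The trilinear form `φ(Ψ_i, c_{jk})`. -/
noncomputable def tri (c : σ → σ → σ → ℝ) (φ : Matrix σ σ ℝ) (Ψ : Matrix σ σ (DiffFun σ))
    (i j k : σ) : DiffFun σ :=
  ∑ γ, ∑ δ, algebraMap ℝ (DiffFun σ) (φ γ δ) * (Ψ γ i * algebraMap ℝ _ (c δ j k))

theorem tri_skew (h : IsMongeFactor c φ Ψ) (i j k : σ) : tri c φ Ψ i j k = - tri c φ Ψ i k j := by
  simp only [tri, ← Finset.sum_neg_distrib]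
  refine Finset.sum_congr rfl fun γ _ => Finset.sum_congr rfl fun δ _ => ?_
  rw [h.skew δ j k, map_neg]
  ring

theorem tri_swap (h : IsMongeFactor c φ Ψ) (i j k : σ) : tri c φ Ψ i j k =
    ∑ γ, ∑ δ, algebraMap ℝ (DiffFun σ) (φ γ δ) * (Ψ δ i * algebraMap ℝ _ (c γ j k)) := by
  rw [tri, Finset.sum_comm]
  refine Finset.sum_congr rfl fun γ _ => Finset.sum_congr rfl fun δ _ => ?_
  rw [h.symm.apply]

theorem tri_cyclic (h : IsMongeFactor c φ Ψ) (i j k : σ) :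
    tri c φ Ψ i j k + tri c φ Ψ j k i + tri c φ Ψ k i j = 0 := by
  rw [← h.cyclic i j k]
  simp only [tri, ← Finset.sum_add_distrib, mul_add]

theorem transpose_mul_constForm_mul_apply (A B : Matrix σ σ (DiffFun σ)) (i j : σ) :
    (Aᵀ * constForm φ * B) i j =
      ∑ α, ∑ β, algebraMap ℝ (DiffFun σ) (φ α β) * A α i * B β j := by
  simp only [Matrix.mul_apply, Matrix.transpose_apply, Matrix.map_apply, Finset.sum_mul]
  rw [Finset.sum_comm]
  refine Finset.sum_congr rfl fun γ _ => Finset.sum_congr rfl fun δ _ => ?_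
  ring

theorem jetPartial_factor (h : IsMongeFactor c φ Ψ) (s γ k : σ) :
    jetPartial s 0 (Ψ γ k) = algebraMap ℝ _ (c γ k s) := by
  rw [h.deriv, Finset.sum_eq_single s]
  · simp [jetPartial_jetU]
  · intro m _ hm
    simp [jetPartial_jetU, hm]
  · simp

theorem jetPartial_metric (h : IsMongeFactor c φ Ψ) (s m k : σ) :
    jetPartial s 0 ((Ψᵀ * constForm φ * Ψ) m k) = tri c φ Ψ k m s + tri c φ Ψ m k s := by
  rw [transpose_mul_constForm_mul_apply, h.tri_swap, tri]
  simp only [map_sum, ← Finset.sum_add_distrib]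
  refine Finset.sum_congr rfl fun γ _ => Finset.sum_congr rfl fun δ _ => ?_
  simp only [Derivation.leibniz, Derivation.map_algebraMap, smul_eq_mul, h.jetPartial_factor]
  ring

/-- Each derivative of the metric is a sum of two values of `tri`; the six values cancel in pairs by
skewness in the last two slots. -/
theorem isMongeMetric (h : IsMongeFactor c φ Ψ) : IsMongeMetric (Ψᵀ * constForm φ * Ψ) := by
  refine ⟨?_, ?_, fun m k s => ?_⟩
  · rw [Matrix.IsSymm, Matrix.transpose_mul, Matrix.transpose_mul, Matrix.transpose_transpose,
      h.transpose_constForm, Matrix.mul_assoc]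
  · rw [Matrix.det_mul, Matrix.det_mul, Matrix.det_transpose]
    refine mul_ne_zero (mul_ne_zero h.det_factor ?_) h.det_factor
    rw [constForm, ← RingHom.mapMatrix_apply, ← RingHom.map_det]
    simpa using h.det_form
  · rw [h.jetPartial_metric, h.jetPartial_metric, h.jetPartial_metric]
    linear_combination h.tri_skew k m s + h.tri_skew m k s + h.tri_skew s k m

/-- The cyclic identity and skewness collapse `c_{skm}` to `-φ(Ψ_s, c_{km})` (`e4`). Contracting
with `u_x` turns the second argument into the total derivative of a column of `Ψ`. -/
theorem dpConnection_metric (h : IsMongeFactor c φ Ψ) :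
    dpConnection (Ψᵀ * constForm φ * Ψ) =
      - ((Ψᵀ * constForm φ * Ψ)⁻¹ * (Ψ.map totalD)ᵀ * Ψ⁻¹ᵀ) := by
  have hs : ((Ψᵀ * constForm φ * Ψ)⁻¹)ᵀ = (Ψᵀ * constForm φ * Ψ)⁻¹ := by
    rw [Matrix.transpose_nonsing_inv, h.isMongeMetric.1.eq]
  have e1 : constForm φ * Ψ * (Ψᵀ * constForm φ * Ψ)⁻¹ = Ψ⁻¹ᵀ := by
    calc constForm φ * Ψ * (Ψᵀ * constForm φ * Ψ)⁻¹
        = constForm φ * (Ψ * Ψ⁻¹) * constForm φ⁻¹ * Ψ⁻¹ᵀ := by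
          rw [h.inv_metric]; simp only [Matrix.mul_assoc]
      _ = Ψ⁻¹ᵀ := by
          rw [Matrix.mul_nonsing_inv _ h.isUnit_det, Matrix.mul_one, h.constForm_mul_inv,
            Matrix.one_mul]
  have e2 : ∀ i j, (Ψᵀ * constForm φ * Ψ.map totalD) i j = ∑ k, tri c φ Ψ i j k * jetU k 1 := by
    intro i j
    rw [transpose_mul_constForm_mul_apply]
    simp only [tri, Matrix.map_apply, h.deriv, Finset.sum_mul, Finset.mul_sum, totalD_jetU,
      zero_add]
    conv_rhs => rw [Finset.sum_comm]
    refine Finset.sum_congr rfl fun γ _ => ?_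
    conv_rhs => rw [Finset.sum_comm]
    refine Finset.sum_congr rfl fun δ _ => Finset.sum_congr rfl fun k _ => ?_
    ring
  have e3 : (Ψ.map totalD)ᵀ * Ψ⁻¹ᵀ =
      (Ψᵀ * constForm φ * Ψ.map totalD)ᵀ * (Ψᵀ * constForm φ * Ψ)⁻¹ := by
    rw [← e1, Matrix.transpose_mul, Matrix.transpose_mul, Matrix.transpose_transpose,
      h.transpose_constForm]
    simp only [Matrix.mul_assoc]
  rw [Matrix.mul_assoc (Ψᵀ * constForm φ * Ψ)⁻¹, e3]
  ext p q
  have e4 : ∀ i j k, (1 / 3 : DiffFun σ) * (jetPartial j 0 ((Ψᵀ * constForm φ * Ψ) i k)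
      - jetPartial k 0 ((Ψᵀ * constForm φ * Ψ) i j)) = - tri c φ Ψ i j k := by
    intro i j k
    rw [h.jetPartial_metric, h.jetPartial_metric]
    linear_combination (1 / 3 : DiffFun σ) * h.tri_cyclic i j k
      + (1 / 3 : DiffFun σ) * h.tri_skew i k j - (1 / 3 : DiffFun σ) * h.tri_skew j i k
  simp only [dpConnection, Matrix.of_apply, e4]
  generalize hF : (Ψᵀ * constForm φ * Ψ)⁻¹ = F at hs ⊢
  generalize Ψᵀ * constForm φ * Ψ.map totalD = B at e2 ⊢
  simp only [Matrix.neg_apply, Matrix.mul_apply, Matrix.transpose_apply, e2, Finset.sum_mul,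
    Finset.mul_sum]
  simp only [← Finset.sum_neg_distrib]
  conv_rhs => rw [Finset.sum_comm]
  conv_lhs => rw [Finset.sum_comm]
  refine Finset.sum_congr rfl fun i _ => ?_
  rw [Finset.sum_comm]
  refine Finset.sum_congr rfl fun j _ => Finset.sum_congr rfl fun k _ => ?_
  have : F q i = F i q := congrFun (congrFun hs i) q
  rw [this]
  ring

/-- By the product rule `D(Ψᵀ α) = (DΨ)ᵀ α + Ψᵀ Dα`, and `Q` cancels the first term. An abstract
left inverse `M` is used so that the lemma also applies after the passage to potentials. -/
theorem firstOrderOp_apply (M P Q : Matrix σ σ (DiffFun σ)) (hM : M * Ψ = 1)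
    (hP : P = M * constForm φ⁻¹ * Mᵀ) (hQ : Q = - (P * (Ψ.map totalD)ᵀ * Mᵀ))
    (α : σ → DiffFun σ) :
    firstOrderOp P Q (Ψᵀ *ᵥ α) = M *ᵥ (constForm φ⁻¹ *ᵥ fun j => totalD (α j)) := by
  have hT : Mᵀ * Ψᵀ = 1 := by
    rw [← Matrix.transpose_mul, mul_eq_one_comm.1 hM, Matrix.transpose_one]
  rw [firstOrderOp_eq, derivation_mulVec, Matrix.transpose_map, Matrix.mulVec_add, hQ,
    Matrix.neg_mulVec, ← Matrix.mulVec_mulVec, Matrix.mulVec_mulVec _ Mᵀ, hT, Matrix.one_mulVec,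
    ← Matrix.mulVec_mulVec, hP]
  simp only [Matrix.mulVec_mulVec, Matrix.mul_assoc]
  rw [hT, Matrix.mul_one]
  abel

theorem doylePotemin_apply (h : IsMongeFactor c φ Ψ) (a : σ → DiffFun σ) :
    doylePotemin (Ψᵀ * constForm φ * Ψ) a = fun i => totalD ((Ψ⁻¹ *ᵥ (constForm φ⁻¹ *ᵥ
      fun j => totalD ((Ψ⁻¹ᵀ *ᵥ fun l => totalD (a l)) j))) i) := by
  have hT : Ψᵀ * Ψ⁻¹ᵀ = 1 := by
    rw [← Matrix.transpose_mul, Matrix.nonsing_inv_mul _ h.isUnit_det, Matrix.transpose_one]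
  have := firstOrderOp_apply Ψ⁻¹ _ _ (Matrix.nonsing_inv_mul _ h.isUnit_det) h.inv_metric
    h.dpConnection_metric (Ψ⁻¹ᵀ *ᵥ fun l => totalD (a l))
  rw [Matrix.mulVec_mulVec, hT, Matrix.one_mulVec] at this
  funext i
  rw [doylePotemin, this]

/-! ### Skew-adjointness and the Jacobi identity -/

/-- The vector-valued bilinear form `c^γ_{km} q^k r^m`. -/
noncomputable def bil (c : σ → σ → σ → ℝ) (q r : σ → DiffFun σ) (γ : σ) : DiffFun σ :=
  ∑ k, ∑ m, algebraMap ℝ (DiffFun σ) (c γ k m) * (q k * r m)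

theorem bil_skew (h : IsMongeFactor c φ Ψ) (q r : σ → DiffFun σ) : bil c q r = - bil c r q := by
  funext γ
  simp only [bil, Pi.neg_apply, ← Finset.sum_neg_distrib]
  rw [Finset.sum_comm]
  refine Finset.sum_congr rfl fun k _ => Finset.sum_congr rfl fun m _ => ?_
  rw [h.skew, map_neg]
  ring

theorem totalD_bil (q r : σ → DiffFun σ) (γ : σ) : totalD (bil c q r γ) =
    bil c (fun i => totalD (q i)) r γ + bil c q (fun i => totalD (r i)) γ := by
  simp only [bil, map_sum, ← Finset.sum_add_distrib]
  refine Finset.sum_congr rfl fun k _ => Finset.sum_congr rfl fun m _ => ?_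
  simp only [Derivation.leibniz, Derivation.map_algebraMap, smul_eq_mul]
  ring

theorem evolution_factor_mulVec (h : IsMongeFactor c φ Ψ) (Q q : σ → DiffFun σ) :
    Ψ.map (evolution Q) *ᵥ q = bil c q Q := by
  funext γ
  simp only [Matrix.mulVec, dotProduct, bil, Matrix.map_apply, h.deriv, evolution_jetU,
    Finset.sum_mul]
  refine Finset.sum_congr rfl fun k _ => Finset.sum_congr rfl fun m _ => ?_
  simp only [Function.iterate_zero, id_eq]
  ring

theorem tri_sum (h : IsMongeFactor c φ Ψ) (q r s : σ → DiffFun σ) :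
    (constForm φ *ᵥ (Ψ *ᵥ q)) ⬝ᵥ bil c r s =
      ∑ i, ∑ j, ∑ k, q i * (r j * s k) * tri c φ Ψ i j k := by
  have e1 : ∀ v : σ → DiffFun σ, v ⬝ᵥ bil c r s =
      ∑ j, ∑ k, r j * s k * ∑ γ, v γ * algebraMap ℝ _ (c γ j k) := by
    intro v
    simp only [dotProduct, bil, Finset.mul_sum]
    refine Finset.sum_comm.trans (Finset.sum_congr rfl fun j _ =>
      Finset.sum_comm.trans (Finset.sum_congr rfl fun k _ => Finset.sum_congr rfl fun γ _ => ?_))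
    ring
  have e2 : ∀ j k, ∑ γ, (constForm φ *ᵥ (Ψ *ᵥ q)) γ * algebraMap ℝ _ (c γ j k) =
      ∑ i, q i * tri c φ Ψ i j k := by
    intro j k
    simp only [h.tri_swap, Matrix.mulVec, dotProduct, Matrix.map_apply, Finset.sum_mul,
      Finset.mul_sum]
    conv_rhs => rw [Finset.sum_comm]
    refine Finset.sum_congr rfl fun γ _ => ?_
    conv_rhs => rw [Finset.sum_comm]
    refine Finset.sum_congr rfl fun δ _ => Finset.sum_congr rfl fun i _ => ?_
    ring
  rw [e1]
  simp only [e2, Finset.mul_sum]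
  conv_rhs => rw [Finset.sum_comm]
  refine Finset.sum_congr rfl fun j _ => ?_
  conv_rhs => rw [Finset.sum_comm]
  refine Finset.sum_congr rfl fun k _ => Finset.sum_congr rfl fun i _ => ?_
  ring

theorem tri_sum_cyclic (h : IsMongeFactor c φ Ψ) (q r s : σ → DiffFun σ) :
    (constForm φ *ᵥ (Ψ *ᵥ q)) ⬝ᵥ bil c r s + (constForm φ *ᵥ (Ψ *ᵥ r)) ⬝ᵥ bil c s q
      + (constForm φ *ᵥ (Ψ *ᵥ s)) ⬝ᵥ bil c q r = 0 := by
  have e1 : ∑ i, ∑ j, ∑ k, q i * (r j * s k) * tri c φ Ψ j k i =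
      ∑ i, ∑ j, ∑ k, r i * (s j * q k) * tri c φ Ψ i j k := by
    refine Finset.sum_comm.trans (Finset.sum_congr rfl fun j _ =>
      Finset.sum_comm.trans (Finset.sum_congr rfl fun k _ =>
        Finset.sum_congr rfl fun i _ => ?_))
    ring
  have e2 : ∑ i, ∑ j, ∑ k, q i * (r j * s k) * tri c φ Ψ k i j =
      ∑ i, ∑ j, ∑ k, s i * (q j * r k) * tri c φ Ψ i j k := by
    refine (Finset.sum_congr rfl fun i _ => Finset.sum_comm).trans
      (Finset.sum_comm.trans (Finset.sum_congr rfl fun k _ => Finset.sum_congr rfl fun i _ =>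
        Finset.sum_congr rfl fun j _ => ?_))
    ring
  rw [h.tri_sum, h.tri_sum, h.tri_sum, ← e1, ← e2]
  simp only [← Finset.sum_add_distrib, ← mul_add, h.tri_cyclic, mul_zero, Finset.sum_const_zero]

/-- The derivative of the operator `D_x ∘ Ψ⁻¹ φ⁻¹ D_x Ψ⁻ᵀ ∘ D_x` along an evolutionary field. -/
theorem evolution_operator_mem (h : IsMongeFactor c φ Ψ) (Q a b α β q r : σ → DiffFun σ)
    (ha : Ψᵀ *ᵥ α = fun i => totalD (a i)) (hb : Ψᵀ *ᵥ β = fun i => totalD (b i))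
    (hq : Ψ *ᵥ q = constForm φ⁻¹ *ᵥ fun i => totalD (α i))
    (hr : Ψ *ᵥ r = constForm φ⁻¹ *ᵥ fun i => totalD (β i)) :
    a ⬝ᵥ (fun i => evolution Q (totalD (r i)))
      + (fun i => totalD (q i)) ⬝ᵥ (fun i => evolution Q (b i))
      - (α ⬝ᵥ bil c r Q - β ⬝ᵥ bil c q Q) ∈ totalDRange σ := by
  rw [mem_totalDRange]
  -- These are the boundary terms of three integrations by parts, along the chain `D a = Ψᵀ α`, `D α
  -- = φ Ψ q`, `D q`. Varying `Ψ` in the relations for `r` and for `β` leaves the two `bil` terms.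
  refine ⟨a ⬝ᵥ (fun i => evolution Q (r i)) - α ⬝ᵥ (constForm φ⁻¹ *ᵥ fun i => evolution Q (β i))
    + q ⬝ᵥ (fun i => evolution Q (b i)), ?_⟩
  have hφ : (constForm φ⁻¹)ᵀ = constForm φ⁻¹ := by
    rw [← Matrix.transpose_map, Matrix.transpose_nonsing_inv, h.symm.eq]
  have e1 : (fun i => totalD (a i)) ⬝ᵥ (fun i => evolution Q (r i)) =
      α ⬝ᵥ (Ψ *ᵥ fun i => evolution Q (r i)) := by
    rw [← ha, Matrix.mulVec_transpose, Matrix.dotProduct_mulVec]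
  have e2 : Ψ *ᵥ (fun i => evolution Q (r i)) =
      constForm φ⁻¹ *ᵥ (fun i => totalD (evolution Q (β i))) - bil c r Q := by
    have := derivation_mulVec (evolution Q) Ψ r
    rw [hr, derivation_mulVec, map_derivation_algebraMap, Matrix.zero_mulVec, zero_add,
      h.evolution_factor_mulVec] at this
    simp only [evolution_totalD] at this
    rw [this, add_sub_cancel_left]
  have e3 : (fun i => totalD (α i)) ⬝ᵥ (constForm φ⁻¹ *ᵥ fun i => evolution Q (β i)) =
      q ⬝ᵥ (Ψᵀ *ᵥ fun i => evolution Q (β i)) := by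
    rw [Matrix.dotProduct_mulVec, ← Matrix.mulVec_transpose, hφ, ← hq, Matrix.dotProduct_mulVec,
      Matrix.vecMul_transpose]
  have e4 : Ψᵀ *ᵥ (fun i => evolution Q (β i)) =
      (fun i => totalD (evolution Q (b i))) - (Ψ.map (evolution Q))ᵀ *ᵥ β := by
    have := derivation_mulVec (evolution Q) Ψᵀ β
    rw [hb, Matrix.transpose_map] at this
    simp only [evolution_totalD] at this
    rw [this, add_sub_cancel_left]
  have e5 : q ⬝ᵥ ((Ψ.map (evolution Q))ᵀ *ᵥ β) = β ⬝ᵥ bil c q Q := by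
    rw [← h.evolution_factor_mulVec, Matrix.dotProduct_mulVec, Matrix.vecMul_transpose,
      dotProduct_comm]
  rw [e2, dotProduct_sub] at e1
  rw [e4, dotProduct_sub, e5] at e3
  have e6 := derivation_mulVec (totalD (σ := σ)) (constForm φ⁻¹) (fun i => evolution Q (β i))
  rw [map_derivation_algebraMap, Matrix.zero_mulVec, zero_add] at e6
  rw [map_add, map_sub, derivation_dotProduct, derivation_dotProduct, derivation_dotProduct, e6]
  simp only [evolution_totalD]
  linear_combination e3 - e1

/-- The factored operator contains three copies of `D` arranged symmetrically around the symmetric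
`φ⁻¹`. The primitive collects the boundary terms of the integrations by parts. -/
theorem doylePotemin_skew_mem (h : IsMongeFactor c φ Ψ) (a b α β q r : σ → DiffFun σ)
    (ha : Ψᵀ *ᵥ α = fun i => totalD (a i)) (hb : Ψᵀ *ᵥ β = fun i => totalD (b i))
    (hq : Ψ *ᵥ q = constForm φ⁻¹ *ᵥ fun i => totalD (α i))
    (hr : Ψ *ᵥ r = constForm φ⁻¹ *ᵥ fun i => totalD (β i)) :
    a ⬝ᵥ (fun i => totalD (r i)) + b ⬝ᵥ (fun i => totalD (q i)) ∈ totalDRange σ := by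
  rw [mem_totalDRange]
  refine ⟨a ⬝ᵥ r + b ⬝ᵥ q - α ⬝ᵥ (constForm φ⁻¹ *ᵥ β), ?_⟩
  have hφ : (constForm φ⁻¹)ᵀ = constForm φ⁻¹ := by
    rw [← Matrix.transpose_map, Matrix.transpose_nonsing_inv, h.symm.eq]
  have e1 : ∀ (a α r : σ → DiffFun σ), (Ψᵀ *ᵥ α = fun i => totalD (a i)) →
      (fun i => totalD (a i)) ⬝ᵥ r = α ⬝ᵥ (Ψ *ᵥ r) := by
    intro a α r ha
    rw [← ha, Matrix.mulVec_transpose, Matrix.dotProduct_mulVec]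
  have e2 : (fun i => totalD (α i)) ⬝ᵥ (constForm φ⁻¹ *ᵥ β) =
      β ⬝ᵥ (constForm φ⁻¹ *ᵥ fun i => totalD (α i)) := by
    rw [Matrix.dotProduct_mulVec, ← Matrix.mulVec_transpose, hφ, dotProduct_comm]
  rw [map_sub, map_add, derivation_dotProduct, derivation_dotProduct, derivation_dotProduct,
    derivation_mulVec, map_derivation_algebraMap, Matrix.zero_mulVec, zero_add, e1 a α r ha,
    e1 b β q hb, hq, hr, e2]
  ring

/-- The total derivative of `α · c(r,s)` plus its cyclic permutations gives the six terms listed,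
plus `Dα · c(r,s)` and its permutations. Since `Dα = φ Ψ q`, the latter sum to zero by
`tri_sum_cyclic`. -/
theorem bil_cyclic_mem (h : IsMongeFactor c φ Ψ) (α β κ q r s : σ → DiffFun σ)
    (hq : Ψ *ᵥ q = constForm φ⁻¹ *ᵥ fun i => totalD (α i))
    (hr : Ψ *ᵥ r = constForm φ⁻¹ *ᵥ fun i => totalD (β i))
    (hs : Ψ *ᵥ s = constForm φ⁻¹ *ᵥ fun i => totalD (κ i)) :
    (α ⬝ᵥ bil c r (fun i => totalD (s i)) - β ⬝ᵥ bil c q (fun i => totalD (s i)))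
      + (β ⬝ᵥ bil c s (fun i => totalD (q i)) - κ ⬝ᵥ bil c r (fun i => totalD (q i)))
      + (κ ⬝ᵥ bil c q (fun i => totalD (r i)) - α ⬝ᵥ bil c s (fun i => totalD (r i))) ∈
      totalDRange σ := by
  rw [mem_totalDRange]
  refine ⟨α ⬝ᵥ bil c r s + β ⬝ᵥ bil c s q + κ ⬝ᵥ bil c q r, ?_⟩
  have e : ∀ (α q : σ → DiffFun σ), (Ψ *ᵥ q = constForm φ⁻¹ *ᵥ fun i => totalD (α i)) →
      (fun i => totalD (α i)) = constForm φ *ᵥ (Ψ *ᵥ q) := by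
    intro α q hq
    rw [hq, Matrix.mulVec_mulVec, h.constForm_mul_inv, Matrix.one_mulVec]
  have e1 : ∀ (α r s : σ → DiffFun σ), α ⬝ᵥ (fun γ => totalD (bil c r s γ)) =
      α ⬝ᵥ bil c r (fun i => totalD (s i)) - α ⬝ᵥ bil c s (fun i => totalD (r i)) := by
    intro α r s
    have : (fun γ => totalD (bil c r s γ)) =
        bil c r (fun i => totalD (s i)) - bil c s (fun i => totalD (r i)) := by
      funext γ
      rw [totalD_bil, h.bil_skew (fun i => totalD (r i)) s]
      simp only [Pi.neg_apply, Pi.sub_apply]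
      ring
    rw [this, dotProduct_sub]
  have e2 := h.tri_sum_cyclic q r s
  rw [map_add, map_add, derivation_dotProduct, derivation_dotProduct, derivation_dotProduct,
    e1, e1, e1, e α q hq, e β r hr, e κ s hs]
  linear_combination - e2

theorem isHamiltonianOperator (h : IsMongeFactor c φ Ψ) :
    IsHamiltonianOperator (doylePotemin (Ψᵀ * constForm φ * Ψ)) := by
  have hT : Ψᵀ * Ψ⁻¹ᵀ = 1 := by
    rw [← Matrix.transpose_mul, Matrix.nonsing_inv_mul _ h.isUnit_det, Matrix.transpose_one]
  have hex : ∀ a : σ → DiffFun σ, ∃ α q : σ → DiffFun σ, (Ψᵀ *ᵥ α = fun i => totalD (a i)) ∧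
      (Ψ *ᵥ q = constForm φ⁻¹ *ᵥ fun i => totalD (α i)) ∧
      doylePotemin (Ψᵀ * constForm φ * Ψ) a = fun i => totalD (q i) := by
    intro a
    refine ⟨Ψ⁻¹ᵀ *ᵥ fun l => totalD (a l), _, ?_, ?_, h.doylePotemin_apply a⟩
    · rw [Matrix.mulVec_mulVec, hT, Matrix.one_mulVec]
    · rw [Matrix.mulVec_mulVec, Matrix.mul_nonsing_inv _ h.isUnit_det, Matrix.one_mulVec]
  choose α q hα hq hA using hex
  refine ⟨fun a b => ?_, fun F G H => ?_⟩
  · obtain ⟨w, hw⟩ := mem_totalDRange.1 (h.doylePotemin_skew_mem a b _ _ _ _ (hα a) (hα b)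
      (hq a) (hq b))
    refine ⟨w, ?_⟩
    rw [← hw, hA, hA, Finset.sum_add_distrib]
    rfl
  · rw [← mem_totalDRange]
    set E : DiffFun σ → σ → DiffFun σ := fun F j => varDeriv j F with hE
    set X : DiffFun σ → σ → DiffFun σ := fun F i => totalD (q (E F) i) with hX
    have hbr : ∀ F G, bracketDensity (doylePotemin (Ψᵀ * constForm φ * Ψ)) F G = E F ⬝ᵥ X G := by
      intro F G
      rw [bracketDensity, hA]
      rfl
    -- Modulo total derivatives, the double bracket of `F`, `G`, `H` is the variation of the density
    -- `E F · X G` along `X H`. Skew-adjointness moves the operator off the variation of `E G`; the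
    -- remaining `bil` terms come from varying the operator itself.
    have key : ∀ F G H, E (E F ⬝ᵥ X G) ⬝ᵥ X H
        - (((fun i => evolution (X H) (E F i)) ⬝ᵥ X G
          - X F ⬝ᵥ (fun i => evolution (X H) (E G i)))
          + (α (E F) ⬝ᵥ bil c (q (E G)) (X H) - α (E G) ⬝ᵥ bil c (q (E F)) (X H))) ∈
        totalDRange σ := by
      intro F G H
      have h1 := evolution_sub_varDeriv_mem (X H) (E F ⬝ᵥ X G)
      have h2 := h.evolution_operator_mem (X H) (E F) (E G) _ _ _ _ (hα _) (hα _) (hq _) (hq _)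
      rw [derivation_dotProduct] at h1
      convert (totalDRange σ).sub_mem h2 h1 using 1
      simp only [hX, dotProduct, hE]
      ring
    -- Symmetry of the second variation makes the six terms with a varied `E` cancel in pairs in the
    -- cyclic sum; `hc` disposes of the `bil` terms.
    have helm : ∀ F G H, (fun i => evolution (X H) (E F i)) ⬝ᵥ X G
        - X H ⬝ᵥ (fun i => evolution (X G) (E F i)) ∈ totalDRange σ := by
      intro F G H
      convert second_variation_symm_mem (X H) (X G) F using 1
      simp only [dotProduct, hE, mul_comm]
    have hc := h.bil_cyclic_mem _ _ _ _ _ _ (hq (E F)) (hq (E G)) (hq (E H))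
    simp only [hbr]
    have hsum := (totalDRange σ).add_mem ((totalDRange σ).add_mem ((totalDRange σ).add_mem
      (key F G H) (key G H F)) (key H F G)) ((totalDRange σ).add_mem
      ((totalDRange σ).add_mem ((totalDRange σ).add_mem (helm F G H) (helm G H F)) (helm H F G))
      hc)
    convert hsum using 1
    ring

end IsMongeFactor

end FactoredMetric

/-! ### Densities of the nonlocal Hamiltonians -/

section Density

variable {σ : Type} [Fintype σ] [DecidableEq σ]

/-- The density `A_{kml} bᵏ bᵐ_x bˡ + P_{km} x bᵏ bᵐ_x + S_{kl} bᵏ bˡ + R_k x bᵏ`. -/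
noncomputable def cubicDensity (A : σ → σ → σ → ℝ) (P S : σ → σ → ℝ) (R : σ → ℝ) : DiffFun σ :=
  ∑ k, ∑ m, ∑ l, algebraMap ℝ _ (A k m l) * (jetU k 0 * jetU m 1 * jetU l 0)
    + ∑ k, ∑ m, algebraMap ℝ _ (P k m) * (jetX * jetU k 0 * jetU m 1)
    + ∑ k, ∑ l, algebraMap ℝ _ (S k l) * (jetU k 0 * jetU l 0)
    + ∑ k, algebraMap ℝ _ (R k) * (jetX * jetU k 0)

theorem jetPartial_zero_cubicDensity (A : σ → σ → σ → ℝ) (P S : σ → σ → ℝ) (R : σ → ℝ) (r : σ) :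
    jetPartial r 0 (cubicDensity A P S R) =
      ∑ m, ∑ l, algebraMap ℝ _ (A r m l + A l m r) * (jetU m 1 * jetU l 0)
      + ∑ m, algebraMap ℝ _ (P r m) * (jetX * jetU m 1)
      + ∑ l, algebraMap ℝ _ (S r l + S l r) * jetU l 0
      + algebraMap ℝ _ (R r) * jetX := by
  have hite : ∀ (x : σ) (f : σ → DiffFun σ),
      (∑ y, if x = r then f y else 0) = if x = r then ∑ y, f y else 0 := by
    intro x f
    split_ifs <;> simp
  have hswap : ∑ k, ∑ m, algebraMap ℝ (DiffFun σ) (A k m r) * (jetU k 0 * jetU m 1) =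
      ∑ m, ∑ l, algebraMap ℝ _ (A l m r) * (jetU m 1 * jetU l 0) :=
    Finset.sum_comm.trans (Finset.sum_congr rfl fun _ _ => Finset.sum_congr rfl fun _ _ => by ring)
  simp only [cubicDensity, map_add, map_sum, Derivation.leibniz, Derivation.map_algebraMap,
    smul_eq_mul, jetPartial_jetU, jetPartial_jetX, mul_add, add_mul, Finset.sum_add_distrib,
    one_ne_zero, and_false, and_true, if_false, mul_zero, zero_add, add_zero,
    mul_ite, mul_one, hite, Finset.sum_ite_eq', Finset.mem_univ, if_true, hswap]
  simp only [mul_comm]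
  ring

theorem jetPartial_one_cubicDensity (A : σ → σ → σ → ℝ) (P S : σ → σ → ℝ) (R : σ → ℝ) (r : σ) :
    jetPartial r 1 (cubicDensity A P S R) =
      ∑ k, ∑ l, algebraMap ℝ _ (A k r l) * (jetU k 0 * jetU l 0)
      + ∑ k, algebraMap ℝ _ (P k r) * (jetX * jetU k 0) := by
  have hite : ∀ (x : σ) (f : σ → DiffFun σ),
      (∑ y, if x = r then f y else 0) = if x = r then ∑ y, f y else 0 := by
    intro x f
    split_ifs <;> simp
  simp only [cubicDensity, map_add, map_sum, Derivation.leibniz, Derivation.map_algebraMap,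
    smul_eq_mul, jetPartial_jetU, jetPartial_jetX, zero_ne_one, and_false, and_true, if_false,
    mul_zero, zero_add, add_zero, mul_ite, mul_one, hite, Finset.sum_ite_eq', Finset.mem_univ,
    if_true, Finset.sum_const_zero]
  simp only [mul_comm]

theorem jetPartial_cubicDensity_of_two_le (A : σ → σ → σ → ℝ) (P S : σ → σ → ℝ) (R : σ → ℝ)
    (r : σ) {n : ℕ} (hn : 2 ≤ n) : jetPartial r n (cubicDensity A P S R) = 0 := by
  have h0 : (0 : ℕ) ≠ n := by omega
  have h1 : (1 : ℕ) ≠ n := by omega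
  simp [cubicDensity, Derivation.leibniz, jetPartial_jetU, jetPartial_jetX, h0, h1]

theorem varDeriv_cubicDensity (A : σ → σ → σ → ℝ) (P S : σ → σ → ℝ) (R : σ → ℝ) (r : σ) :
    varDeriv r (cubicDensity A P S R) =
      ∑ m, ∑ l, algebraMap ℝ _ (A r m l + A l m r - A m r l - A l r m) * (jetU m 1 * jetU l 0)
      + ∑ m, algebraMap ℝ _ (P r m - P m r) * (jetX * jetU m 1)
      + ∑ l, algebraMap ℝ _ (S r l + S l r - P l r) * jetU l 0
      + algebraMap ℝ _ (R r) * jetX := by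
  rw [varDeriv_eq_sum r _ {0, 1} (fun k hk => by
    by_contra hn
    simp only [Finset.mem_insert, Finset.mem_singleton] at hn
    exact hk (jetPartial_cubicDensity_of_two_le A P S R r (by omega)))]
  rw [Finset.sum_pair zero_ne_one]
  simp only [Function.iterate_zero, Function.iterate_one, id_eq, pow_zero, pow_one, one_mul,
    jetPartial_zero_cubicDensity, jetPartial_one_cubicDensity]
  have e1 : totalD (∑ k, ∑ l, algebraMap ℝ (DiffFun σ) (A k r l) * (jetU k 0 * jetU l 0)) =
      ∑ m, ∑ l, algebraMap ℝ (DiffFun σ) (A m r l + A l r m) * (jetU m 1 * jetU l 0) := by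
    simp only [map_sum, Derivation.leibniz, Derivation.map_algebraMap, smul_eq_mul, totalD_jetU,
      mul_zero, add_zero, zero_add, mul_add, map_add, add_mul, Finset.sum_add_distrib]
    rw [add_comm]
    refine congrArg₂ _ (Finset.sum_congr rfl fun _ _ => Finset.sum_congr rfl fun _ _ => by ring)
      (Finset.sum_comm.trans (Finset.sum_congr rfl fun _ _ => Finset.sum_congr rfl fun _ _ => ?_))
    ring
  have e2 : totalD (∑ k, algebraMap ℝ (DiffFun σ) (P k r) * (jetX * jetU k 0)) =
      ∑ m, algebraMap ℝ (DiffFun σ) (P m r) * (jetX * jetU m 1)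
        + ∑ l, algebraMap ℝ (DiffFun σ) (P l r) * jetU l 0 := by
    simp only [map_sum, Derivation.leibniz, Derivation.map_algebraMap, smul_eq_mul, totalD_jetU,
      totalD_jetX, mul_zero, add_zero, zero_add, mul_add, mul_one, Finset.sum_add_distrib]
  rw [map_add, e1, e2]
  simp only [map_sub, map_add, sub_mul, add_mul, Finset.sum_add_distrib, Finset.sum_sub_distrib]
  ring

/-- In potentials `Z = D ζ` with `ζ` affine in `b` and `x`. By `firstOrderOp_apply` the covector `Ψᵀ
φ ζ` is mapped to `Ψ⁻¹ Z`, so it has to be minus a variational derivative. The hypotheses `hcyc` and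
`hG` supply the symmetries of its coefficients that this requires. -/
theorem IsMongeFactor.isHamiltonianSystem {c : σ → σ → σ → ℝ} {φ : Matrix σ σ ℝ}
    {Ψ : Matrix σ σ (DiffFun σ)} (h : IsMongeFactor c φ Ψ) (w o : σ → σ → ℝ) (ξ : σ → ℝ)
    (hΨ : ∀ γ k, Ψ γ k = ∑ m, algebraMap ℝ _ (c γ k m) * jetU m 0 + algebraMap ℝ _ (w γ k))
    (hcyc : ∀ i j k, ∑ γ, ∑ δ, φ γ δ * (o γ i * c δ j k + o γ j * c δ k i + o γ k * c δ i j) = 0)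
    (hG : ∀ k l, ∑ γ, ∑ δ, φ γ δ * (w γ k * o δ l - w γ l * o δ k) =
      ∑ γ, ∑ δ, φ γ δ * (c γ k l * ξ δ)) :
    IsHamiltonianSystem (Ψᵀ * constForm φ * Ψ)
      (Ψ⁻¹ *ᵥ fun γ => ∑ k, algebraMap ℝ _ (o γ k) * jetU k 0 + algebraMap ℝ _ (ξ γ)) := by
  set Z : σ → DiffFun σ := fun γ => ∑ k, algebraMap ℝ _ (o γ k) * jetU k 0 + algebraMap ℝ _ (ξ γ)
  set ζ : σ → DiffFun σ := fun γ => ∑ l, algebraMap ℝ _ (o γ l) * jetU l 0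
    + algebraMap ℝ _ (ξ γ) * jetX
  have hζ : (fun γ => totalD (ζ γ)) = toPotentials ∘ Z := by
    funext γ
    simp [ζ, Z, Derivation.leibniz, totalD_jetU, totalD_jetX, toPotentials_jetU,
      toPotentials_algebraMap_real]
  -- Coefficients of the covector `Ψᵀ φ ζ` at `b_x b`, `x b_x`, `b` and `x` respectively.
  set T : σ → σ → σ → ℝ := fun k m l => ∑ γ, ∑ δ, φ γ δ * (c γ k m * o δ l)
  set P : σ → σ → ℝ := fun k m => ∑ γ, ∑ δ, φ γ δ * (c γ k m * ξ δ)
  set G : σ → σ → ℝ := fun k l => ∑ γ, ∑ δ, φ γ δ * (w γ k * o δ l)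
  set R : σ → ℝ := fun k => ∑ γ, ∑ δ, φ γ δ * (w γ k * ξ δ)
  have hTskew : ∀ k m l, T k m l = - T m k l := by
    intro k m l
    simp only [T, ← Finset.sum_neg_distrib]
    refine Finset.sum_congr rfl fun γ _ => Finset.sum_congr rfl fun δ _ => ?_
    rw [h.skew γ k m]
    ring
  have hPskew : ∀ k m, P k m = - P m k := by
    intro k m
    simp only [P, ← Finset.sum_neg_distrib]
    refine Finset.sum_congr rfl fun γ _ => Finset.sum_congr rfl fun δ _ => ?_
    rw [h.skew γ k m]
    ring
  have hTcyc : ∀ i j k, T j k i + T k i j + T i j k = 0 := by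
    intro i j k
    rw [← hcyc i j k, Finset.sum_comm]
    simp only [T, ← Finset.sum_add_distrib]
    refine Finset.sum_congr rfl fun γ _ => Finset.sum_congr rfl fun δ _ => ?_
    rw [h.symm.apply γ δ]
    ring
  have hGP : ∀ k l, G k l - G l k = P k l := by
    intro k l
    simp only [P, ← hG, G, ← Finset.sum_sub_distrib, mul_sub]
  have hY : ∀ k, ((Ψ.map toPotentials)ᵀ *ᵥ (constForm φ *ᵥ ζ)) k =
      ∑ m, ∑ l, algebraMap ℝ _ (T k m l) * (jetU m 1 * jetU l 0)
      + ∑ m, algebraMap ℝ _ (P k m) * (jetX * jetU m 1)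
      + ∑ l, algebraMap ℝ _ (G k l) * jetU l 0 + algebraMap ℝ _ (R k) * jetX := by
    intro k
    have hT : ∀ γ, (Ψ.map toPotentials)ᵀ k γ =
        ∑ m, algebraMap ℝ _ (c γ k m) * jetU m 1 + algebraMap ℝ _ (w γ k) := by
      intro γ
      simp [hΨ, toPotentials_jetU, toPotentials_algebraMap_real]
    have e : ((Ψ.map toPotentials)ᵀ *ᵥ (constForm φ *ᵥ ζ)) k =
        ∑ γ, ∑ δ, algebraMap ℝ _ (φ γ δ) *
          ((∑ m, algebraMap ℝ _ (c γ k m) * jetU m 1 + algebraMap ℝ _ (w γ k)) * ζ δ) := by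
      simp only [Matrix.mulVec, dotProduct, hT, Finset.mul_sum, Matrix.map_apply]
      refine Finset.sum_congr rfl fun γ _ => Finset.sum_congr rfl fun δ _ => ?_
      ring
    rw [e]
    simp only [ζ, mul_add, add_mul, Finset.sum_add_distrib]
    have e1 : ∑ m, ∑ l, algebraMap ℝ (DiffFun σ) (T k m l) * (jetU m 1 * jetU l 0) =
        ∑ γ, ∑ δ, algebraMap ℝ _ (φ γ δ) * ((∑ m, algebraMap ℝ _ (c γ k m) * jetU m 1) *
          ∑ l, algebraMap ℝ _ (o δ l) * jetU l 0) := by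
      simp only [T, map_sum, map_mul, Finset.sum_mul, Finset.mul_sum]
      trans ∑ m, ∑ γ, ∑ l, ∑ δ, algebraMap ℝ (DiffFun σ) (φ γ δ) * (algebraMap ℝ _ (c γ k m) *
        jetU m 1 * (algebraMap ℝ _ (o δ l) * jetU l 0))
      · refine Finset.sum_congr rfl fun m _ => Finset.sum_comm.trans
          (Finset.sum_congr rfl fun γ _ => Finset.sum_congr rfl fun l _ =>
            Finset.sum_congr rfl fun δ _ => ?_)
        ring
      · refine Finset.sum_comm.trans (Finset.sum_congr rfl fun γ _ => ?_)
        exact (Finset.sum_congr rfl fun m _ => Finset.sum_comm).trans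
          (Finset.sum_comm.trans (Finset.sum_congr rfl fun δ _ => Finset.sum_comm))
    have e2 : ∑ m, algebraMap ℝ (DiffFun σ) (P k m) * (jetX * jetU m 1) =
        ∑ γ, ∑ δ, algebraMap ℝ _ (φ γ δ) * ((∑ m, algebraMap ℝ _ (c γ k m) * jetU m 1) *
          (algebraMap ℝ _ (ξ δ) * jetX)) := by
      simp only [P, map_sum, map_mul, Finset.mul_sum, Finset.sum_mul]
      refine Finset.sum_comm.trans (Finset.sum_congr rfl fun γ _ => Finset.sum_comm.trans
        (Finset.sum_congr rfl fun δ _ => Finset.sum_congr rfl fun m _ => ?_))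
      ring
    have e3 : ∑ l, algebraMap ℝ (DiffFun σ) (G k l) * jetU l 0 =
        ∑ γ, ∑ δ, algebraMap ℝ _ (φ γ δ) * (algebraMap ℝ _ (w γ k) *
          ∑ l, algebraMap ℝ _ (o δ l) * jetU l 0) := by
      simp only [G, map_sum, map_mul, Finset.mul_sum, Finset.sum_mul]
      refine Finset.sum_comm.trans (Finset.sum_congr rfl fun γ _ => Finset.sum_comm.trans
        (Finset.sum_congr rfl fun δ _ => Finset.sum_congr rfl fun m _ => ?_))
      ring
    have e4 : algebraMap ℝ (DiffFun σ) (R k) * jetX =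
        ∑ γ, ∑ δ, algebraMap ℝ _ (φ γ δ) * (algebraMap ℝ _ (w γ k) *
          (algebraMap ℝ _ (ξ δ) * jetX)) := by
      simp only [R, map_sum, map_mul, Finset.sum_mul]
      refine Finset.sum_congr rfl fun γ _ => Finset.sum_congr rfl fun δ _ => ?_
      ring
    rw [e1, e2, e3, e4]
    ring
  -- Homotopy formula: pair the covector with `-b` and divide each term by its degree in `b`, hence
  -- the factors 1/3, 1/2 and 1. By `hGP`, `G - P/2` is the symmetric part of `G`, the only part
  -- that contributes to the quadratic form in `b`.
  obtain ⟨dens, hdens⟩ : ∃ d : DiffFun σ, d = cubicDensity (fun k m l => - (1 / 3) * T k m l)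
      (fun k m => - (1 / 2) * P k m) (fun k l => - (1 / 2) * (G k l - 1 / 2 * P k l))
      (fun k => - R k) := ⟨_, rfl⟩
  have hE : ∀ k, - varDeriv k dens = ((Ψ.map toPotentials)ᵀ *ᵥ (constForm φ *ᵥ ζ)) k := by
    intro k
    rw [hY, hdens, varDeriv_cubicDensity]
    simp only [neg_add, ← Finset.sum_neg_distrib, ← neg_mul, ← map_neg]
    refine congrArg₂ _ (congrArg₂ _ (congrArg₂ _ (Finset.sum_congr rfl fun m _ =>
      Finset.sum_congr rfl fun l _ => ?_) (Finset.sum_congr rfl fun m _ => ?_))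
      (Finset.sum_congr rfl fun l _ => ?_)) ?_
    · congr 2
      linarith [hTskew k m l, hTskew l m k, hTskew m k l, hTskew l k m, hTskew k l m,
        hTskew m l k, hTcyc k m l, hTcyc k l m]
    · congr 2
      linarith [hPskew k m]
    · congr 2
      linarith [hPskew k l, hGP k l]
    · congr 2
      ring
  refine ⟨dens, fun i => ?_⟩
  simp only [hE]
  set t : DiffFun σ →+* DiffFun σ := toPotentials
  have hMΨ : Ψ⁻¹.map t * Ψ.map t = 1 := by
    rw [← Matrix.map_mul, Matrix.nonsing_inv_mul _ h.isUnit_det]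
    simp
  have hconst : ∀ A : Matrix σ σ ℝ, (constForm A).map t = constForm A := by
    intro A
    ext i j
    simp [t, toPotentials_algebraMap_real]
  have hD : (Ψ.map totalD).map t = (Ψ.map t).map totalD := by
    ext i j
    simp [t, toPotentials_totalD]
  rw [toPotentials_totalD]
  have key := IsMongeFactor.firstOrderOp_apply (φ := φ) (Ψ := Ψ.map t) (Ψ⁻¹.map t)
    (((Ψᵀ * constForm φ * Ψ)⁻¹).map t) ((dpConnection (Ψᵀ * constForm φ * Ψ)).map t) hMΨ
    (by rw [h.inv_metric, Matrix.map_mul, Matrix.map_mul, hconst, Matrix.transpose_map])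
    (by
      have hneg : ∀ X Y W : Matrix σ σ (DiffFun σ),
          (- (X * Y * W)).map t = - (X.map t * Y.map t * W.map t) := by
        intro X Y W
        rw [← Matrix.map_mul, ← Matrix.map_mul]
        ext i j
        exact map_neg t _
      rw [h.dpConnection_metric, ← hD]
      exact hneg _ _ _)
    (constForm φ *ᵥ ζ)
  have hZ : (fun j => totalD ((constForm φ *ᵥ ζ) j)) = constForm φ *ᵥ (t ∘ Z) := by
    rw [derivation_mulVec, map_derivation_algebraMap, Matrix.zero_mulVec, zero_add, hζ]
  rw [hZ, Matrix.mulVec_mulVec _ (constForm φ⁻¹), h.inv_mul_constForm, Matrix.one_mulVec] at key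
  change totalD (t ((Ψ⁻¹ *ᵥ Z) i)) =
    totalD (firstOrderOp _ _ ((Ψ.map t)ᵀ *ᵥ (constForm φ *ᵥ ζ)) i)
  rw [key, RingHom.map_mulVec]

end Density

/-! ### The linear algebra of the WDVV data -/

section WDVVAlgebra

variable {N : ℕ} [NeZero N]

theorem WIdx.beta_lt_nu (γ : WIdx N) : γ.beta < γ.nu := by
  have h1 : 0 < γ.1.2.val := γ.2.1
  have h2 : γ.1.2.val ≤ γ.1.1.val := γ.2.2
  change γ.1.2.val - 1 < γ.1.1.val
  omega

theorem WIdx.nu_ne_zero (γ : WIdx N) : γ.nu ≠ 0 :=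
  (lt_of_le_of_lt (Fin.zero_le _) γ.beta_lt_nu).ne'

/-- The index `γ = (ν, β + 1)`. -/
def WIdx.ofLT (β ν : Fin N) (h : β < ν) : WIdx N :=
  ⟨(ν, ⟨β.val + 1, lt_of_le_of_lt (Nat.succ_le_of_lt h) ν.isLt⟩),
    Nat.succ_pos _, Nat.succ_le_of_lt h⟩

theorem WIdx.beta_ofLT (β ν : Fin N) (h : β < ν) : (WIdx.ofLT β ν h).beta = β := rfl

theorem WIdx.nu_ofLT (β ν : Fin N) (h : β < ν) : (WIdx.ofLT β ν h).nu = ν := rfl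

theorem WIdx.ofLT_beta_nu (γ : WIdx N) : WIdx.ofLT γ.beta γ.nu γ.beta_lt_nu = γ := by
  obtain ⟨⟨m, i⟩, h1, h2⟩ := γ
  apply Subtype.ext
  refine Prod.ext rfl (Fin.ext ?_)
  have h3 : 0 < i.val := h1
  change i.val - 1 + 1 = i.val
  omega

theorem sum_WIdx (g : Fin N → Fin N → ℝ) (hg : ∀ a, g a a = 0) :
    ∑ a, ∑ b, g a b = ∑ γ : WIdx N, (g γ.beta γ.nu + g γ.nu γ.beta) := by
  have key : ∀ f : Fin N → Fin N → ℝ,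
      ∑ γ : WIdx N, f γ.beta γ.nu = ∑ a, ∑ b, if a < b then f a b else 0 := by
    intro f
    rw [← Finset.sum_product', ← Finset.sum_filter]
    refine Finset.sum_bij' (fun γ _ => (γ.beta, γ.nu))
      (fun q hq => WIdx.ofLT q.1 q.2 (Finset.mem_filter.1 hq).2) ?_ ?_ ?_ ?_ ?_
    · intro γ _
      exact Finset.mem_filter.2 ⟨by simp, γ.beta_lt_nu⟩
    · simp
    · intro γ _
      exact γ.ofLT_beta_nu
    · intro q _
      rfl
    · intro γ _
      rfl
  rw [Finset.sum_add_distrib, key g, key (fun a b => g b a)]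
  rw [Finset.sum_comm (f := fun a b => if a < b then g b a else 0)]
  simp only [← Finset.sum_add_distrib]
  refine Finset.sum_congr rfl fun a _ => Finset.sum_congr rfl fun b _ => ?_
  rcases lt_trichotomy a b with h | h | h
  · simp [h, h.not_gt]
  · simp [h, hg]
  · simp [h, h.not_gt]

/-- The index `γ` covers exactly the entries above the diagonal. This converts an equality of
vectors indexed by `γ` into one of matrices. -/
theorem skew_eq_zero {X : Matrix (Fin N) (Fin N) ℝ} (hX : Xᵀ = - X)
    (h : ∀ γ : WIdx N, X γ.beta γ.nu = 0) : X = 0 := by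
  have hs : ∀ a b, X b a = - X a b := fun a b => congrFun (congrFun hX a) b
  ext a b
  rcases lt_trichotomy a b with hab | rfl | hab
  · exact h (WIdx.ofLT a b hab)
  · have := hs a a
    simp only [Matrix.zero_apply]
    linarith
  · have := h (WIdx.ofLT b a hab)
    rw [WIdx.beta_ofLT, WIdx.nu_ofLT] at this
    rw [hs b a, this, neg_zero]
    rfl

/-! ### The bracket of symmetric matrices -/

/-- The bracket `X h Y - Y h X`. -/
def twistedBracket (h X Y : Matrix (Fin N) (Fin N) ℝ) : Matrix (Fin N) (Fin N) ℝ :=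
  X * h * Y - Y * h * X

theorem twistedBracket_swap (h X Y : Matrix (Fin N) (Fin N) ℝ) :
    twistedBracket h X Y = - twistedBracket h Y X := (neg_sub _ _).symm

theorem twistedBracket_add_left (h X Y Z : Matrix (Fin N) (Fin N) ℝ) :
    twistedBracket h (X + Y) Z = twistedBracket h X Z + twistedBracket h Y Z := by
  simp only [twistedBracket, add_mul, mul_add]
  abel

theorem twistedBracket_add_right (h X Y Z : Matrix (Fin N) (Fin N) ℝ) :
    twistedBracket h X (Y + Z) = twistedBracket h X Y + twistedBracket h X Z := by
  simp only [twistedBracket, add_mul, mul_add]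
  abel

theorem twistedBracket_sum_smul_left {ι : Type*} [Fintype ι] (h Z : Matrix (Fin N) (Fin N) ℝ)
    (u : ι → ℝ) (X : ι → Matrix (Fin N) (Fin N) ℝ) :
    twistedBracket h (∑ i, u i • X i) Z = ∑ i, u i • twistedBracket h (X i) Z := by
  simp only [twistedBracket, Finset.sum_mul, Finset.mul_sum, smul_sub, Finset.sum_sub_distrib,
    Matrix.smul_mul, Matrix.mul_smul]

theorem twistedBracket_sum_smul_right {ι : Type*} [Fintype ι] (h Z : Matrix (Fin N) (Fin N) ℝ)
    (u : ι → ℝ) (X : ι → Matrix (Fin N) (Fin N) ℝ) :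
    twistedBracket h Z (∑ i, u i • X i) = ∑ i, u i • twistedBracket h Z (X i) := by
  simp only [twistedBracket, Finset.sum_mul, Finset.mul_sum, smul_sub, Finset.sum_sub_distrib,
    Matrix.smul_mul, Matrix.mul_smul]

theorem twistedBracket_transpose {h X Y : Matrix (Fin N) (Fin N) ℝ} (hh : hᵀ = h) (hX : Xᵀ = X)
    (hY : Yᵀ = Y) : (twistedBracket h X Y)ᵀ = - twistedBracket h X Y := by
  simp only [twistedBracket, Matrix.transpose_sub, Matrix.transpose_mul, hh, hX, hY, neg_sub,
    Matrix.mul_assoc]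

/-! ### The WDVV constants as entries of brackets -/

theorem pairDelta_comm (k : WIdx N) (a b : Fin N) : pairDelta k a b = pairDelta k b a := by
  rw [pairDelta, pairDelta, max_comm, min_comm]

theorem pairDelta_zero_left (k : WIdx N) (b : Fin N) : pairDelta k 0 b = 0 := by
  rw [pairDelta, if_neg]
  intro h
  have h1 := k.2.1
  rw [h] at h1
  simp at h1

/-- The symmetric matrix with entries `δ_{k,(a,b)}`. -/
def symUnit (k : WIdx N) : Matrix (Fin N) (Fin N) ℝ := Matrix.of fun a b => pairDelta k a b

theorem symUnit_transpose (k : WIdx N) : (symUnit k)ᵀ = symUnit k := by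
  ext a b
  exact pairDelta_comm k b a

/-- The symmetric matrix whose first row and column are those of index `ρ` of `η`, and whose
other entries vanish. -/
def borderMat (η : Matrix (Fin N) (Fin N) ℝ) (ρ : Fin N) : Matrix (Fin N) (Fin N) ℝ :=
  Matrix.of fun a b => if a = 0 then η ρ b else if b = 0 then η ρ a else 0

theorem borderMat_transpose (η : Matrix (Fin N) (Fin N) ℝ) (ρ : Fin N) :
    (borderMat η ρ)ᵀ = borderMat η ρ := by
  ext a b
  simp only [borderMat, Matrix.transpose_apply, Matrix.of_apply]
  split_ifs with h1 h2 h2 <;> simp_all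

theorem sum_symUnit_apply (u : WIdx N → ℝ) (a b : Fin N) (ha : a ≠ 0) (hb : b ≠ 0) :
    (∑ k, u k • symUnit k) a b =
      u ⟨(max a b, min a b), lt_min (Fin.pos_iff_ne_zero.2 ha) (Fin.pos_iff_ne_zero.2 hb),
        min_le_max⟩ := by
  rw [Matrix.sum_apply, Finset.sum_eq_single (⟨(max a b, min a b),
    lt_min (Fin.pos_iff_ne_zero.2 ha) (Fin.pos_iff_ne_zero.2 hb), min_le_max⟩ : WIdx N)]
  · simp [symUnit, pairDelta]
  · intro k _ hk
    simp only [symUnit, pairDelta, Matrix.smul_apply, Matrix.of_apply, smul_eq_mul]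
    rw [if_neg fun h => hk (Subtype.ext h), mul_zero]
  · simp

theorem sum_symUnit_zero_left (u : WIdx N → ℝ) (b : Fin N) :
    (∑ k, u k • symUnit k) 0 b = 0 := by
  rw [Matrix.sum_apply]
  simp [symUnit, pairDelta_zero_left]

theorem sum_symUnit_transpose (u : WIdx N → ℝ) :
    (∑ k, u k • symUnit k)ᵀ = ∑ k, u k • symUnit k := by
  rw [Matrix.transpose_sum]
  simp only [Matrix.transpose_smul, symUnit_transpose]

theorem sum_symUnit_add_borderMat (η : Matrix (Fin N) (Fin N) ℝ) (ρ : Fin N)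
    {S : Matrix (Fin N) (Fin N) ℝ} (hS : Sᵀ = S) (h0 : ∀ b, S 0 b = η ρ b) :
    ∑ k : WIdx N, S k.1.2 k.1.1 • symUnit k + borderMat η ρ = S := by
  have hs : ∀ a b, S b a = S a b := fun a b => congrFun (congrFun hS a) b
  ext a b
  rw [Matrix.add_apply]
  by_cases ha : a = 0
  · subst ha
    rw [sum_symUnit_zero_left, h0]
    simp [borderMat]
  · by_cases hb : b = 0
    · subst hb
      have := sum_symUnit_zero_left (fun k : WIdx N => S k.1.2 k.1.1) a
      rw [← sum_symUnit_transpose, Matrix.transpose_apply] at this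
      rw [this, hs, h0]
      simp [borderMat, ha]
    · rw [sum_symUnit_apply _ a b ha hb]
      simp only [borderMat, Matrix.of_apply, ha, hb, if_false, add_zero]
      rcases le_total a b with h | h
      · simp [h]
      · simp [h, hs]

theorem inv_transpose {η : Matrix (Fin N) (Fin N) ℝ} (hsymm : η.IsSymm) : (η⁻¹)ᵀ = η⁻¹ := by
  rw [Matrix.transpose_nonsing_inv, hsymm.eq]

/-- The summation index `m` stands in the left slot, so that contraction with `u^m` builds up the
field matrix there. -/
theorem psiTwo_eq {η : Matrix (Fin N) (Fin N) ℝ} (hsymm : η.IsSymm) (γ k m : WIdx N) :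
    psiTwo η γ k m = twistedBracket η⁻¹ (symUnit m) (symUnit k) γ.beta γ.nu := by
  have hh : ∀ a b, η⁻¹ b a = η⁻¹ a b := fun a b => congrFun (congrFun (inv_transpose hsymm) a) b
  rw [twistedBracket, Matrix.sub_apply]
  simp only [Matrix.mul_apply, Finset.sum_mul, psiTwo, ← Finset.sum_sub_distrib, symUnit,
    Matrix.of_apply]
  refine Finset.sum_congr rfl fun a _ => Finset.sum_congr rfl fun b _ => ?_
  rw [hh a b, pairDelta_comm k a γ.nu, pairDelta_comm m a γ.nu]
  ring

theorem borderMat_zero_mul_inv {η : Matrix (Fin N) (Fin N) ℝ} (hdet : η.det ≠ 0) (ρ b : Fin N) :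
    (borderMat η ρ * η⁻¹) 0 b = if ρ = b then 1 else 0 := by
  have : (borderMat η ρ * η⁻¹) 0 b = (η * η⁻¹) ρ b := by
    simp [Matrix.mul_apply, borderMat]
  rw [this, Matrix.mul_nonsing_inv _ hdet.isUnit, Matrix.one_apply]

theorem borderMat_mul_apply {η : Matrix (Fin N) (Fin N) ℝ} (ρ : Fin N)
    (X : Matrix (Fin N) (Fin N) ℝ) {a : Fin N} (ha : a ≠ 0) (b : Fin N) :
    (borderMat η ρ * X) a b = η ρ a * X 0 b := by
  simp [Matrix.mul_apply, borderMat, ha]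

theorem mul_borderMat_apply {η : Matrix (Fin N) (Fin N) ℝ} (ρ : Fin N)
    (X : Matrix (Fin N) (Fin N) ℝ) (a : Fin N) {b : Fin N} (hb : b ≠ 0) :
    (X * borderMat η ρ) a b = X a 0 * η ρ b := by
  simp [Matrix.mul_apply, borderMat, hb]

/-- The case distinction in the constants disappears: the first row of `B_ρ η⁻¹` is the unit vector
`e_ρ`, because `η η⁻¹ = 1`, and `E_k` has zero first row. This accounts for `β = 1`. -/
theorem omegaCoeff_eq {η : Matrix (Fin N) (Fin N) ℝ} (hsymm : η.IsSymm) (hdet : η.det ≠ 0)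
    (ρ : Fin N) (γ k : WIdx N) :
    omegaCoeff η ρ γ k = twistedBracket η⁻¹ (borderMat η ρ) (symUnit k) γ.beta γ.nu := by
  have hh : ∀ a b, η⁻¹ b a = η⁻¹ a b := fun a b => congrFun (congrFun (inv_transpose hsymm) a) b
  rw [twistedBracket, Matrix.sub_apply, mul_borderMat_apply _ _ _ γ.nu_ne_zero, omegaCoeff]
  split_ifs with h
  · rw [h, Matrix.mul_apply]
    simp [borderMat_zero_mul_inv hdet, Matrix.mul_apply, symUnit, pairDelta_zero_left,
      pairDelta_comm k γ.nu]
  · rw [Matrix.mul_assoc, borderMat_mul_apply _ _ h, Matrix.mul_apply, Matrix.mul_apply,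
      Finset.mul_sum, Finset.sum_mul, ← Finset.sum_sub_distrib]
    refine Finset.sum_congr rfl fun a _ => ?_
    simp only [symUnit, Matrix.of_apply]
    rw [hh 0 a, pairDelta_comm k a γ.nu]
    ring

/-- In the first row the bracket involves the first entries of `e_μ` and `e_l`, which vanish as
neither index is the first one. -/
theorem xiCoeff_eq {η : Matrix (Fin N) (Fin N) ℝ} (hdet : η.det ≠ 0) {l μ : Fin N} (hl : l ≠ 0)
    (hμ : μ ≠ 0) (γ : WIdx N) : xiCoeff η l μ γ =
      twistedBracket η⁻¹ (borderMat η μ) (borderMat η l) γ.beta γ.nu := by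
  rw [twistedBracket, Matrix.sub_apply, mul_borderMat_apply _ _ _ γ.nu_ne_zero,
    mul_borderMat_apply _ _ _ γ.nu_ne_zero, xiCoeff]
  split_ifs with h
  · rw [h, borderMat_zero_mul_inv hdet, borderMat_zero_mul_inv hdet, if_neg hμ, if_neg hl]
    ring
  · rw [borderMat_mul_apply _ _ h, borderMat_mul_apply _ _ h]
    ring

/-! ### The form `φ` as a trace form and its Bianchi identity -/

/-- `φ` raises both indices: pairing the entries `(a, b)` and `(b, a)` of a skew matrix
antisymmetrizes the product of two copies of `η⁻¹`. -/
theorem sum_phiCoeff_mul {η : Matrix (Fin N) (Fin N) ℝ} (hsymm : η.IsSymm)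
    {Y : Matrix (Fin N) (Fin N) ℝ} (hY : Yᵀ = - Y) (γ : WIdx N) :
    ∑ δ, phiCoeff η γ δ * Y δ.beta δ.nu = (η⁻¹ * Y * η⁻¹) γ.beta γ.nu := by
  have hh : ∀ a b, η⁻¹ b a = η⁻¹ a b := fun a b => congrFun (congrFun (inv_transpose hsymm) a) b
  have hs : ∀ a b, Y b a = - Y a b := fun a b => congrFun (congrFun hY a) b
  have h1 : (η⁻¹ * Y * η⁻¹) γ.beta γ.nu =
      ∑ a, ∑ b, η⁻¹ γ.beta a * Y a b * η⁻¹ b γ.nu := by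
    simp only [Matrix.mul_apply, Finset.sum_mul]
    exact Finset.sum_comm
  rw [h1, sum_WIdx]
  · refine Finset.sum_congr rfl fun δ _ => ?_
    rw [phiCoeff, hs δ.beta δ.nu, hh γ.nu δ.nu, hh γ.nu δ.beta, hh γ.beta δ.nu]
    ring
  · intro a
    have := hs a a
    have h0 : Y a a = 0 := by linarith
    rw [h0]
    ring

theorem sum_phiCoeff_mul_mul {η : Matrix (Fin N) (Fin N) ℝ} (hsymm : η.IsSymm)
    {X Y : Matrix (Fin N) (Fin N) ℝ} (hX : Xᵀ = - X) (hY : Yᵀ = - Y) :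
    ∑ γ : WIdx N, ∑ δ : WIdx N, phiCoeff η γ δ * (X γ.beta γ.nu * Y δ.beta δ.nu) =
      - (1 / 2) * (X * η⁻¹ * (Y * η⁻¹)).trace := by
  have hsX : ∀ a b, X b a = - X a b := fun a b => congrFun (congrFun hX a) b
  set Z := η⁻¹ * Y * η⁻¹ with hZ
  have hsZ' : Zᵀ = - Z := by
    rw [hZ, Matrix.transpose_mul, Matrix.transpose_mul, inv_transpose hsymm, hY]
    simp [Matrix.mul_assoc]
  have hsZ : ∀ a b, Z b a = - Z a b := fun a b => congrFun (congrFun hsZ' a) b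
  have h1 : ∀ γ : WIdx N, ∑ δ : WIdx N, phiCoeff η γ δ * (X γ.beta γ.nu * Y δ.beta δ.nu) =
      X γ.beta γ.nu * Z γ.beta γ.nu := by
    intro γ
    rw [hZ, ← sum_phiCoeff_mul hsymm hY, Finset.mul_sum]
    refine Finset.sum_congr rfl fun δ _ => ?_
    ring
  have h2 : (X * η⁻¹ * (Y * η⁻¹)).trace = - ∑ a, ∑ b, X a b * Z a b := by
    rw [show X * η⁻¹ * (Y * η⁻¹) = X * Z by rw [hZ]; simp only [Matrix.mul_assoc], Matrix.trace]
    simp only [Matrix.diag_apply, Matrix.mul_apply, ← Finset.sum_neg_distrib]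
    refine Finset.sum_congr rfl fun a _ => Finset.sum_congr rfl fun b _ => ?_
    rw [hsZ a b]
    ring
  rw [h2, sum_WIdx]
  · simp only [h1]
    rw [← Finset.sum_neg_distrib, Finset.mul_sum]
    refine Finset.sum_congr rfl fun γ _ => ?_
    rw [hsX γ.beta γ.nu, hsZ γ.beta γ.nu]
    ring
  · intro a
    have := hsX a a
    have h0 : X a a = 0 := by linarith
    rw [h0, zero_mul]

/-- The form `φ` on two brackets. -/
noncomputable def bracketForm (η a b c d : Matrix (Fin N) (Fin N) ℝ) : ℝ :=
  ∑ γ : WIdx N, ∑ δ : WIdx N, phiCoeff η γ δ *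
    (twistedBracket η⁻¹ a b γ.beta γ.nu * twistedBracket η⁻¹ c d δ.beta δ.nu)

theorem bracketForm_eq {η a b c d : Matrix (Fin N) (Fin N) ℝ} (hsymm : η.IsSymm) (ha : aᵀ = a)
    (hb : bᵀ = b) (hc : cᵀ = c) (hd : dᵀ = d) : bracketForm η a b c d =
      - (1 / 2) * ((a * η⁻¹ * (b * η⁻¹) * (c * η⁻¹) * (d * η⁻¹)).trace
        - (a * η⁻¹ * (b * η⁻¹) * (d * η⁻¹) * (c * η⁻¹)).trace
        - (a * η⁻¹ * (c * η⁻¹) * (d * η⁻¹) * (b * η⁻¹)).trace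
        + (a * η⁻¹ * (d * η⁻¹) * (c * η⁻¹) * (b * η⁻¹)).trace) := by
  have hh := inv_transpose hsymm
  rw [bracketForm, sum_phiCoeff_mul_mul hsymm (twistedBracket_transpose hh ha hb)
    (twistedBracket_transpose hh hc hd)]
  congr 1
  -- Cyclicity of the trace lets every word start with `a`; in this normal form the Bianchi identity
  -- is a cancellation of equal terms.
  rw [show a * η⁻¹ * (c * η⁻¹) * (d * η⁻¹) * (b * η⁻¹) =
      (a * η⁻¹ * (c * η⁻¹) * (d * η⁻¹)) * (b * η⁻¹) from rfl,
    Matrix.trace_mul_comm (a * η⁻¹ * (c * η⁻¹) * (d * η⁻¹)),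
    Matrix.trace_mul_comm (a * η⁻¹ * (d * η⁻¹) * (c * η⁻¹)), ← Matrix.trace_sub,
    ← Matrix.trace_sub, ← Matrix.trace_add]
  congr 1
  simp only [twistedBracket, sub_mul, mul_sub, Matrix.mul_assoc]
  abel

/-- After multiplication by `η⁻¹` brackets become commutators, and `tr([a,b][c,d]) =
tr(a[b,[c,d]])`; this is the Jacobi identity paired with `a`. -/
theorem bracketForm_bianchi {η a b c d : Matrix (Fin N) (Fin N) ℝ} (hsymm : η.IsSymm)
    (ha : aᵀ = a) (hb : bᵀ = b) (hc : cᵀ = c) (hd : dᵀ = d) :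
    bracketForm η a b c d + bracketForm η a c d b + bracketForm η a d b c = 0 := by
  rw [bracketForm_eq hsymm ha hb hc hd, bracketForm_eq hsymm ha hc hd hb,
    bracketForm_eq hsymm ha hd hb hc]
  ring

theorem bracketForm_swap_right (η a b c d : Matrix (Fin N) (Fin N) ℝ) :
    bracketForm η a b c d = - bracketForm η a b d c := by
  simp only [bracketForm, ← Finset.sum_neg_distrib]
  refine Finset.sum_congr rfl fun γ _ => Finset.sum_congr rfl fun δ _ => ?_
  rw [twistedBracket_swap η⁻¹ c d, Matrix.neg_apply]
  ring

theorem phiCoeff_comm {η : Matrix (Fin N) (Fin N) ℝ} (hsymm : η.IsSymm) (γ δ : WIdx N) :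
    phiCoeff η γ δ = phiCoeff η δ γ := by
  have hh : ∀ a b, η⁻¹ b a = η⁻¹ a b := fun a b => congrFun (congrFun (inv_transpose hsymm) a) b
  rw [phiCoeff, phiCoeff, hh γ.nu δ.nu, hh γ.beta δ.beta]
  ring

theorem bracketForm_comm {η : Matrix (Fin N) (Fin N) ℝ} (hsymm : η.IsSymm)
    (a b c d : Matrix (Fin N) (Fin N) ℝ) :
    bracketForm η a b c d = bracketForm η c d a b := by
  rw [bracketForm, Finset.sum_comm, bracketForm]
  refine Finset.sum_congr rfl fun γ _ => Finset.sum_congr rfl fun δ _ => ?_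
  rw [phiCoeff_comm hsymm δ γ]
  ring

/-- A kernel vector extends to a skew matrix `X` with `η⁻¹ X η⁻¹ = 0`. -/
theorem det_phiCoeff_ne_zero {η : Matrix (Fin N) (Fin N) ℝ} (hsymm : η.IsSymm)
    (hdet : η.det ≠ 0) : (Matrix.of (phiCoeff η)).det ≠ 0 := by
  intro h0
  obtain ⟨v, hv0, hv⟩ := Matrix.exists_mulVec_eq_zero_iff.2 h0
  apply hv0
  set X : Matrix (Fin N) (Fin N) ℝ := Matrix.of fun a b =>
    if h : a < b then v (WIdx.ofLT a b h) else if h : b < a then - v (WIdx.ofLT b a h) else 0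
    with hXdef
  have hX : Xᵀ = - X := by
    ext a b
    simp only [hXdef, Matrix.transpose_apply, Matrix.of_apply, Matrix.neg_apply]
    rcases lt_trichotomy a b with h | rfl | h
    · simp [h, h.not_gt]
    · simp
    · simp [h, h.not_gt]
  have hXv : ∀ γ : WIdx N, X γ.beta γ.nu = v γ := by
    intro γ
    simp only [hXdef, Matrix.of_apply]
    rw [dif_pos γ.beta_lt_nu, γ.ofLT_beta_nu]
  have hsk : (η⁻¹ * X * η⁻¹)ᵀ = - (η⁻¹ * X * η⁻¹) := by
    rw [Matrix.transpose_mul, Matrix.transpose_mul, inv_transpose hsymm, hX]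
    simp [Matrix.mul_assoc]
  have hz := skew_eq_zero hsk fun γ => by
    rw [← sum_phiCoeff_mul hsymm hX]
    simp only [hXv]
    exact congrFun hv γ
  have hX0 : X = 0 := by
    calc X = (η * η⁻¹) * X * (η⁻¹ * η) := by
          rw [Matrix.mul_nonsing_inv _ hdet.isUnit, Matrix.nonsing_inv_mul _ hdet.isUnit,
            Matrix.one_mul, Matrix.mul_one]
      _ = η * (η⁻¹ * X * η⁻¹) * η := by simp only [Matrix.mul_assoc]
      _ = 0 := by rw [hz]; simp
  funext γ
  rw [← hXv, hX0]
  rfl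

/-- The symmetric matrix with first row `η_ρ` and remaining entries `u`. -/
def fieldMat (η : Matrix (Fin N) (Fin N) ℝ) (ρ : Fin N) (u : WIdx N → ℝ) :
    Matrix (Fin N) (Fin N) ℝ :=
  ∑ k, u k • symUnit k + borderMat η ρ

theorem psiMat_mulVec {η : Matrix (Fin N) (Fin N) ℝ} (hsymm : η.IsSymm) (hdet : η.det ≠ 0)
    (p : Fin N) (u v : WIdx N → ℝ) (γ : WIdx N) : (psiMat η p u *ᵥ v) γ =
      twistedBracket η⁻¹ (fieldMat η p u) (∑ k, v k • symUnit k) γ.beta γ.nu := by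
  rw [twistedBracket_sum_smul_right, Matrix.sum_apply]
  refine Finset.sum_congr rfl fun k _ => ?_
  rw [fieldMat, twistedBracket_add_left, twistedBracket_sum_smul_left, Matrix.smul_apply,
    Matrix.add_apply, Matrix.sum_apply]
  simp only [psiMat, Matrix.of_apply, psiTwo_eq hsymm, omegaCoeff_eq hsymm hdet,
    Algebra.algebraMap_self, RingHom.id_apply, Matrix.smul_apply, smul_eq_mul]
  rw [mul_comm]
  simp only [mul_comm]

theorem zVec_eq {η : Matrix (Fin N) (Fin N) ℝ} (hsymm : η.IsSymm) (hdet : η.det ≠ 0)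
    {p μ : Fin N} (hp : p ≠ 0) (hμ : μ ≠ 0) (u : WIdx N → ℝ) (γ : WIdx N) :
    zVec η p μ u γ = twistedBracket η⁻¹ (borderMat η μ) (fieldMat η p u) γ.beta γ.nu := by
  rw [fieldMat, twistedBracket_add_right, twistedBracket_sum_smul_right, Matrix.add_apply,
    Matrix.sum_apply]
  simp only [zVec, omegaCoeff_eq hsymm hdet, xiCoeff_eq hdet hp hμ,
    Algebra.algebraMap_self, RingHom.id_apply, Matrix.smul_apply, smul_eq_mul]
  simp only [mul_comm]

/-- Skewness changes `-[B_μ, U_p]` into `[U_p, B_μ]`, which completes the sum over `E_k` to the full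
field matrix. -/
theorem psiMat_mulVec_sub_zVec {η : Matrix (Fin N) (Fin N) ℝ} (hsymm : η.IsSymm)
    (hdet : η.det ≠ 0) {p μ : Fin N} (hp : p ≠ 0) (hμ : μ ≠ 0) (u v : WIdx N → ℝ) (γ : WIdx N) :
    (psiMat η p u *ᵥ v) γ - zVec η p μ u γ =
      twistedBracket η⁻¹ (fieldMat η p u) (fieldMat η μ v) γ.beta γ.nu := by
  rw [psiMat_mulVec hsymm hdet, zVec_eq hsymm hdet hp hμ, twistedBracket_swap _ (borderMat η μ),
    Matrix.neg_apply, sub_neg_eq_add, ← Matrix.add_apply, ← twistedBracket_add_right]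
  rfl

end WDVVAlgebra

/-! ### Generic invertibility of `ψ` -/

section Krylov

variable {N : ℕ}

theorem exists_dotProduct_eq (f : (Fin N → ℝ) →ₗ[ℝ] ℝ) :
    ∃ w : Fin N → ℝ, ∀ x, f x = w ⬝ᵥ x := by
  refine ⟨fun i => f (Pi.single i 1), fun x => ?_⟩
  rw [LinearMap.pi_apply_eq_sum_univ f x, dotProduct]
  refine Finset.sum_congr rfl fun i _ => ?_
  have : (fun j => if i = j then (1 : ℝ) else 0) = Pi.single i 1 := by
    funext j
    simp [Pi.single_apply, eq_comm]
  rw [smul_eq_mul, mul_comm, this]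

theorem exists_dotProduct_eq_ite {k : ℕ} {v : Fin k → Fin N → ℝ} (hv : LinearIndependent ℝ v)
    (i : Fin k) : ∃ w : Fin N → ℝ, ∀ j, w ⬝ᵥ v j = if j = i then 1 else 0 := by
  obtain ⟨g, hg⟩ := LinearMap.exists_leftInverse_of_injective
    (Finsupp.linearCombination ℝ v) (LinearMap.ker_eq_bot.2 hv)
  obtain ⟨w, hw⟩ := exists_dotProduct_eq ((Finsupp.lapply i).comp g)
  refine ⟨w, fun j => ?_⟩
  have h1 := LinearMap.congr_fun hg (Finsupp.single j 1)
  rw [LinearMap.comp_apply, Finsupp.linearCombination_single, one_smul] at h1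
  rw [← hw, LinearMap.comp_apply, h1]
  simp [Finsupp.single_apply]

theorem exists_annihilator {k : ℕ} (v : Fin k → Fin N → ℝ) (hk : k < N) :
    ∃ w : Fin N → ℝ, w ≠ 0 ∧ ∀ x ∈ Submodule.span ℝ (Set.range v), w ⬝ᵥ x = 0 := by
  have hlt : Submodule.span ℝ (Set.range v) < ⊤ := by
    rw [lt_top_iff_ne_top]
    intro h
    have h1 := finrank_range_le_card (R := ℝ) v
    rw [Set.finrank, h, finrank_top] at h1
    simp at h1
    omega
  obtain ⟨f, hf0, hf⟩ := Submodule.exists_le_ker_of_lt_top _ hlt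
  obtain ⟨w, hw⟩ := exists_dotProduct_eq f
  refine ⟨w, ?_, fun x hx => ?_⟩
  · rintro rfl
    exact hf0 (LinearMap.ext fun x => by rw [hw]; simp)
  · rw [← hw]
    exact hf hx

/-- If a Krylov space of a self-adjoint operator `h A` of dimension `m + 1 < N` is invariant, some
rank-one perturbation of `A` that is invisible to the first `m` vectors leads out of it. -/
theorem exists_perturbation {h A : Matrix (Fin N) (Fin N) ℝ} (hh : hᵀ = h) (hh0 : IsUnit h.det)
    (hA : Aᵀ = A) (e : Fin N → ℝ) {m : ℕ} (hm : m + 1 < N)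
    (hli : LinearIndependent ℝ (fun j : Fin (m + 1) => (h * A) ^ (j : ℕ) *ᵥ e))
    (hinv : (h * A) ^ (m + 1) *ᵥ e ∈
      Submodule.span ℝ (Set.range fun j : Fin (m + 1) => (h * A) ^ (j : ℕ) *ᵥ e)) :
    ∃ w : Fin N → ℝ, (∀ j < m, w ⬝ᵥ ((h * A) ^ j *ᵥ e) = 0) ∧ w ⬝ᵥ ((h * A) ^ m *ᵥ e) = 1 ∧
      h *ᵥ w ∉ Submodule.span ℝ (Set.range fun j : Fin (m + 1) => (h * A) ^ (j : ℕ) *ᵥ e) := by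
  set v : Fin (m + 1) → Fin N → ℝ := fun j => (h * A) ^ (j : ℕ) *ᵥ e with hv
  set K := Submodule.span ℝ (Set.range v) with hK
  have hKB : ∀ x ∈ K, (h * A) *ᵥ x ∈ K := by
    intro x hx
    induction hx using Submodule.span_induction with
    | mem x hx =>
      obtain ⟨j, rfl⟩ := hx
      rw [hv, Matrix.mulVec_mulVec, ← pow_succ']
      rcases Nat.lt_or_ge ((j : ℕ) + 1) (m + 1) with h1 | h1
      · exact Submodule.subset_span ⟨⟨j + 1, h1⟩, rfl⟩
      · have : (j : ℕ) + 1 = m + 1 := by omega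
        rw [this]
        exact hinv
    | zero => simp
    | add x y _ _ hx hy => rw [Matrix.mulVec_add]; exact K.add_mem hx hy
    | smul a x _ hx => rw [Matrix.mulVec_smul]; exact K.smul_mem a hx
  have hKBn : ∀ (n : ℕ), ∀ x ∈ K, (h * A) ^ n *ᵥ x ∈ K := by
    intro n
    induction n with
    | zero => intro x hx; simpa using hx
    | succ n ih =>
      intro x hx
      rw [pow_succ', ← Matrix.mulVec_mulVec]
      exact hKB _ (ih x hx)
  -- `w` is dual to the last Krylov vector, and `ζ` annihilates the whole space `K`. If no
  -- admissible perturbation left `K`, both `h w` and `h (w + ζ)`, hence `h ζ`, would lie in `K`.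
  obtain ⟨w, hw⟩ := exists_dotProduct_eq_ite hli (Fin.last m)
  obtain ⟨ζ, hζ0, hζ⟩ := exists_annihilator v hm
  have hw1 : ∀ j < m, w ⬝ᵥ ((h * A) ^ j *ᵥ e) = 0 := by
    intro j hj
    have := hw ⟨j, by omega⟩
    rwa [if_neg (by simp [Fin.ext_iff]; omega)] at this
  have hw2 : w ⬝ᵥ ((h * A) ^ m *ᵥ e) = 1 := by
    have := hw (Fin.last m)
    rwa [if_pos rfl] at this
  by_contra hcon
  push Not at hcon
  have hw3 : h *ᵥ w ∈ K := hcon w hw1 hw2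
  have hw4 : h *ᵥ (w + ζ) ∈ K := by
    refine hcon (w + ζ) (fun j hj => ?_) ?_
    · rw [add_dotProduct, hw1 j hj, hζ _ (Submodule.subset_span ⟨⟨j, by omega⟩, rfl⟩), add_zero]
    · have : ζ ⬝ᵥ ((h * A) ^ m *ᵥ e) = 0 := hζ _ (Submodule.subset_span ⟨Fin.last m, rfl⟩)
      rw [add_dotProduct, hw2, this, add_zero]
  have hz : h *ᵥ ζ ∈ K := by
    rw [Matrix.mulVec_add] at hw4
    simpa using K.sub_mem hw4 hw3
  have hz0 : h *ᵥ ζ ≠ 0 := by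
    intro h0
    apply hζ0
    have := congrArg (fun x => h⁻¹ *ᵥ x) h0
    simpa [Matrix.mulVec_mulVec, Matrix.nonsing_inv_mul _ hh0] using this
  -- Symmetry of `(hA)^n h` exchanges `w` and `ζ`; then `(hA)^n h w` stays in `K`, where `ζ`
  -- vanishes.
  have horth : ∀ n : ℕ, w ⬝ᵥ ((h * A) ^ n *ᵥ (h *ᵥ ζ)) = 0 := by
    intro n
    have hs : ((h * A) ^ n * h)ᵀ = (h * A) ^ n * h := by
      have hsc : SemiconjBy h (A * h) (h * A) := (Matrix.mul_assoc h A h).symm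
      rw [Matrix.transpose_mul, Matrix.transpose_pow, Matrix.transpose_mul, hh, hA]
      exact hsc.pow_right n
    have h1 := hζ _ (hKBn n _ hw3)
    rw [Matrix.mulVec_mulVec] at h1 ⊢
    rw [Matrix.dotProduct_mulVec, ← Matrix.mulVec_transpose, hs, dotProduct_comm]
    exact h1
  obtain ⟨q, hq⟩ := (Submodule.mem_span_range_iff_exists_fun ℝ).1 hz
  have hne : (Finset.univ.filter fun j => q j ≠ 0).Nonempty := by
    by_contra hemp
    rw [Finset.not_nonempty_iff_eq_empty, Finset.filter_eq_empty_iff] at hemp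
    apply hz0
    rw [← hq]
    refine Finset.sum_eq_zero fun j _ => ?_
    have := hemp (Finset.mem_univ j)
    rw [not_not.1 this, zero_smul]
  set j₀ := (Finset.univ.filter fun j => q j ≠ 0).max' hne with hj₀
  have hqj : q j₀ ≠ 0 := (Finset.mem_filter.1 (Finset.max'_mem _ hne)).2
  have hmax : ∀ j, j₀ < j → q j = 0 := by
    intro j hj
    by_contra hqj
    exact absurd (Finset.le_max' _ j (Finset.mem_filter.2 ⟨Finset.mem_univ j, hqj⟩))
      (not_le.2 hj)
  apply hqj
  -- This power shifts the top Krylov component of `h ζ` to the last vector, where `w` takes the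
  -- value 1; the lower components land where `w` vanishes. So the top coefficient is zero, a
  -- contradiction.
  have h2 := horth (m - j₀)
  rw [← hq, Matrix.mulVec_sum, dotProduct_sum, Finset.sum_eq_single j₀] at h2
  · rw [Matrix.mulVec_smul, hv, Matrix.mulVec_mulVec, ← pow_add, dotProduct_smul,
      show m - (j₀ : ℕ) + j₀ = m by omega, hw2] at h2
    simpa using h2
  · intro j _ hj
    rcases lt_or_gt_of_ne hj with h3 | h3
    · rw [Matrix.mulVec_smul, hv, Matrix.mulVec_mulVec, ← pow_add, dotProduct_smul, hw1, smul_zero]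
      have := Fin.lt_def.1 h3
      omega
    · rw [hmax j h3]
      simp
  · simp

/-- Adding `w wᵀ` leaves the Krylov vectors up to the `m`-th unchanged and adds `h w`, which lies
outside their span, to the next one. The condition `m ≠ 0` gives `w ⊥ e`, so that `A e` is
preserved. -/
theorem exists_krylov_succ {h A : Matrix (Fin N) (Fin N) ℝ} (hh : hᵀ = h) (hh0 : IsUnit h.det)
    (hA : Aᵀ = A) (e : Fin N → ℝ) {m : ℕ} (hm0 : m ≠ 0) (hm : m + 1 < N)
    (hli : LinearIndependent ℝ (fun j : Fin (m + 1) => (h * A) ^ (j : ℕ) *ᵥ e)) :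
    ∃ A' : Matrix (Fin N) (Fin N) ℝ, A'ᵀ = A' ∧ A' *ᵥ e = A *ᵥ e ∧
      LinearIndependent ℝ (fun j : Fin (m + 1 + 1) => (h * A') ^ (j : ℕ) *ᵥ e) := by
  by_cases hinv : (h * A) ^ (m + 1) *ᵥ e ∈
      Submodule.span ℝ (Set.range fun j : Fin (m + 1) => (h * A) ^ (j : ℕ) *ᵥ e)
  swap
  · exact ⟨A, hA, rfl, linearIndependent_finSucc'.2 ⟨hli, hinv⟩⟩
  obtain ⟨w, hw1, hw2, hw3⟩ := exists_perturbation hh hh0 hA e hm hli hinv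
  have hact : ∀ x, (A + Matrix.vecMulVec w w) *ᵥ x = A *ᵥ x + (w ⬝ᵥ x) • w := by
    intro x
    rw [Matrix.add_mulVec, Matrix.vecMulVec_mulVec]
    simp
  have hpow : ∀ j ≤ m, (h * (A + Matrix.vecMulVec w w)) ^ j *ᵥ e = (h * A) ^ j *ᵥ e := by
    intro j
    induction j with
    | zero => intro _; simp
    | succ j ih =>
      intro hj
      rw [pow_succ', ← Matrix.mulVec_mulVec, ih (by omega), ← Matrix.mulVec_mulVec, hact,
        hw1 j (by omega), zero_smul, add_zero, pow_succ', ← Matrix.mulVec_mulVec,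
        ← Matrix.mulVec_mulVec]
  have hr : Fin.init (fun j : Fin (m + 1 + 1) =>
      (h * (A + Matrix.vecMulVec w w)) ^ (j : ℕ) *ᵥ e) =
      fun j : Fin (m + 1) => (h * A) ^ (j : ℕ) *ᵥ e := by
    funext j
    exact hpow j (by omega)
  refine ⟨A + Matrix.vecMulVec w w, ?_, ?_, linearIndependent_finSucc'.2 ?_⟩
  · rw [Matrix.transpose_add, hA, Matrix.transpose_vecMulVec]
  · have := hw1 0 (by omega)
    rw [pow_zero, Matrix.one_mulVec] at this
    rw [hact, this, zero_smul, add_zero]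
  · rw [hr]
    refine ⟨hli, fun hmem => hw3 ?_⟩
    change (h * (A + Matrix.vecMulVec w w)) ^ (m + 1) *ᵥ e ∈ _ at hmem
    rw [pow_succ', ← Matrix.mulVec_mulVec, hpow m le_rfl, ← Matrix.mulVec_mulVec, hact, hw2,
      one_smul, Matrix.mulVec_add, Matrix.mulVec_mulVec, Matrix.mulVec_mulVec, ← pow_succ'] at hmem
    simpa using Submodule.sub_mem _ hmem hinv

/-- For a nondegenerate symmetric form and independent `e`, `h A₀ e` there is a symmetric `A` with
`A e = A₀ e` such that `e` is a cyclic vector of the self-adjoint operator `h A`. -/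
theorem exists_cyclic {h A₀ : Matrix (Fin N) (Fin N) ℝ} (hh : hᵀ = h) (hh0 : IsUnit h.det)
    (hA : A₀ᵀ = A₀) (e : Fin N → ℝ) (hN : 2 ≤ N)
    (hli : LinearIndependent ℝ (fun j : Fin 2 => (h * A₀) ^ (j : ℕ) *ᵥ e)) :
    ∃ A : Matrix (Fin N) (Fin N) ℝ, Aᵀ = A ∧ A *ᵥ e = A₀ *ᵥ e ∧
      LinearIndependent ℝ (fun j : Fin N => (h * A) ^ (j : ℕ) *ᵥ e) := by
  have key : ∀ k, 2 ≤ k → k ≤ N → ∃ A : Matrix (Fin N) (Fin N) ℝ, Aᵀ = A ∧ A *ᵥ e = A₀ *ᵥ e ∧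
      LinearIndependent ℝ (fun j : Fin k => (h * A) ^ (j : ℕ) *ᵥ e) := by
    intro k hk
    induction k, hk using Nat.le_induction with
    | base => intro _; exact ⟨A₀, hA, rfl, hli⟩
    | succ k hk ih =>
      intro hkN
      obtain ⟨A, hA1, hA2, hA3⟩ := ih (by omega)
      obtain ⟨m, rfl⟩ : ∃ m, k = m + 1 := ⟨k - 1, by omega⟩
      obtain ⟨A', h1, h2, h3⟩ := exists_krylov_succ hh hh0 hA1 e (by omega) (by omega) hA3
      exact ⟨A', h1, h2.trans hA2, h3⟩
  exact key N hN le_rfl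

/-- `W (hA)^(j+1) e = A h W (hA)^j e`, so `W` kills the Krylov vectors one after the other, and
these span everything. -/
theorem eq_zero_of_commute_cyclic {h A W : Matrix (Fin N) (Fin N) ℝ} (e : Fin N → ℝ)
    (hli : LinearIndependent ℝ (fun j : Fin N => (h * A) ^ (j : ℕ) *ᵥ e))
    (hcomm : A * h * W = W * h * A) (hW : W *ᵥ e = 0) : W = 0 := by
  have hpow : ∀ j : ℕ, W *ᵥ ((h * A) ^ j *ᵥ e) = 0 := by
    intro j
    induction j with
    | zero => simpa using hW
    | succ j ih =>
      rw [pow_succ', ← Matrix.mulVec_mulVec, Matrix.mulVec_mulVec, ← Matrix.mul_assoc, ← hcomm,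
        ← Matrix.mulVec_mulVec, ih, Matrix.mulVec_zero]
  have htop := hli.span_eq_top_of_card_eq_finrank' (by simp)
  have hall : ∀ x, W *ᵥ x = 0 := by
    intro x
    have hx : x ∈ Submodule.span ℝ (Set.range fun j : Fin N => (h * A) ^ (j : ℕ) *ᵥ e) := by
      rw [htop]; trivial
    induction hx using Submodule.span_induction with
    | mem x hx => obtain ⟨j, rfl⟩ := hx; exact hpow j
    | zero => simp
    | add x y _ _ hx hy => rw [Matrix.mulVec_add, hx, hy, add_zero]
    | smul a x _ hx => rw [Matrix.mulVec_smul, hx, smul_zero]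
  ext i j
  have := congrFun (hall (Pi.single j 1)) i
  simpa using this

end Krylov

section GenericInvertibility

variable {N : ℕ} [NeZero N]

/-- `η⁻¹ B_p` sends the first basis vector to the `p`-th one, so the first two Krylov vectors are
independent and `exists_cyclic` applies. The entries of the matrix it yields are the point `u`. -/
theorem exists_det_psiMat_ne_zero (hN : 2 ≤ N) {η : Matrix (Fin N) (Fin N) ℝ}
    (hsymm : η.IsSymm) (hdet : η.det ≠ 0) {p : Fin N} (hp : p ≠ 0) :
    ∃ u : WIdx N → ℝ, (psiMat η p u).det ≠ 0 := by
  have hb0 : borderMat η p *ᵥ Pi.single 0 1 = η p := by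
    funext a
    simp only [Matrix.mulVec_single_one, Matrix.col_apply, borderMat, Matrix.of_apply]
    split_ifs with h
    · rw [h]
    · rfl
  have hrow : η⁻¹ *ᵥ η p = Pi.single p 1 := by
    have h1 : η p = η *ᵥ Pi.single p 1 := by
      funext a
      simp only [Matrix.mulVec_single_one, Matrix.col_apply]
      exact hsymm.apply a p
    rw [h1, Matrix.mulVec_mulVec, Matrix.nonsing_inv_mul _ hdet.isUnit, Matrix.one_mulVec]
  have hli : LinearIndependent ℝ
      (fun j : Fin 2 => (η⁻¹ * borderMat η p) ^ (j : ℕ) *ᵥ (Pi.single 0 1 : Fin N → ℝ)) := by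
    have hpair : (fun j : Fin 2 => (η⁻¹ * borderMat η p) ^ (j : ℕ) *ᵥ
        (Pi.single 0 1 : Fin N → ℝ)) = ![Pi.single 0 1, Pi.single p 1] := by
      funext j
      fin_cases j
      · change (η⁻¹ * borderMat η p) ^ 0 *ᵥ (Pi.single 0 1 : Fin N → ℝ) = Pi.single 0 1
        rw [pow_zero, Matrix.one_mulVec]
      · change (η⁻¹ * borderMat η p) ^ 1 *ᵥ (Pi.single 0 1 : Fin N → ℝ) = Pi.single p 1
        rw [pow_one, ← Matrix.mulVec_mulVec, hb0, hrow]
    rw [hpair, LinearIndependent.pair_iff]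
    intro s t hst
    have h1 := congrFun hst 0
    have h2 := congrFun hst p
    simp [hp, hp.symm] at h1 h2
    exact ⟨h1, h2⟩
  obtain ⟨A, hA, hAe, hAli⟩ := exists_cyclic (inv_transpose hsymm)
    (Matrix.isUnit_nonsing_inv_det _ hdet.isUnit) (borderMat_transpose η p) (Pi.single 0 1) hN hli
  rw [hb0] at hAe
  have hA0 : ∀ b, A 0 b = η p b := by
    intro b
    have h1 := congrFun hAe b
    rw [Matrix.mulVec_single_one, Matrix.col_apply] at h1
    rw [← h1]
    exact congrFun (congrFun hA b) 0
  refine ⟨fun k => A k.1.2 k.1.1, fun h0 => ?_⟩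
  obtain ⟨v, hv0, hv⟩ := Matrix.exists_mulVec_eq_zero_iff.2 h0
  apply hv0
  have hfield : fieldMat η p (fun k => A k.1.2 k.1.1) = A := sum_symUnit_add_borderMat η p hA hA0
  have hbr := skew_eq_zero (twistedBracket_transpose (inv_transpose hsymm) hA
    (sum_symUnit_transpose v)) fun γ => by
      have := congrFun hv γ
      rwa [psiMat_mulVec hsymm hdet, hfield] at this
  have hW : ∑ k, v k • symUnit k = 0 := by
    refine eq_zero_of_commute_cyclic _ hAli (sub_eq_zero.1 hbr) ?_
    funext a
    rw [Matrix.mulVec_single_one, Matrix.col_apply, ← sum_symUnit_transpose]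
    exact sum_symUnit_zero_left v a
  funext k
  have h1 := k.2.1
  have h2 := k.2.2
  have h3 : 0 < k.1.1 := lt_of_lt_of_le h1 h2
  have := sum_symUnit_apply v k.1.1 k.1.2 h3.ne' h1.ne'
  rw [hW] at this
  simp only [h2, max_eq_left, min_eq_right] at this
  exact this.symm

/-- The determinant comes from a polynomial that is nonzero at the point found above. The evaluation
ignores the jet order, which is harmless because only order 0 occurs. -/
theorem det_psiMat_jet_ne_zero (hN : 2 ≤ N) {η : Matrix (Fin N) (Fin N) ℝ}
    (hsymm : η.IsSymm) (hdet : η.det ≠ 0) {p : Fin N} (hp : p ≠ 0) :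
    (psiMat η p (fun I => (jetU I 0 : DiffFun (WIdx N)))).det ≠ 0 := by
  obtain ⟨u, hu⟩ := exists_det_psiMat_ne_zero hN hsymm hdet hp
  set B : Matrix (WIdx N) (WIdx N) (JetPoly (WIdx N)) := Matrix.of fun γ k =>
    ∑ m, MvPolynomial.C (psiTwo η γ k m) * MvPolynomial.X (some (m, 0))
      + MvPolynomial.C (omegaCoeff η p γ k) with hB
  have hC : ∀ r : ℝ, algebraMap (JetPoly (WIdx N)) (DiffFun (WIdx N)) (MvPolynomial.C r) =
      algebraMap ℝ (DiffFun (WIdx N)) r := by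
    intro r
    rw [IsScalarTower.algebraMap_apply ℝ (JetPoly (WIdx N)) (DiffFun (WIdx N)),
      MvPolynomial.algebraMap_eq]
  have h1 : psiMat η p (fun I => (jetU I 0 : DiffFun (WIdx N))) =
      (algebraMap (JetPoly (WIdx N)) (DiffFun (WIdx N))).mapMatrix B := by
    ext γ k
    simp only [psiMat, hB, RingHom.mapMatrix_apply, Matrix.map_apply, Matrix.of_apply, map_add,
      map_sum, map_mul, hC, jetU]
  set ev : JetPoly (WIdx N) →+* ℝ := MvPolynomial.eval fun z => z.elim 0 fun q => u q.1
  have h2 : psiMat η p u = ev.mapMatrix B := by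
    ext γ k
    simp [psiMat, hB, ev]
  rw [h1, ← RingHom.map_det]
  apply jetPoly_map_ne_zero
  intro h0
  apply hu
  rw [h2, ← RingHom.map_det, h0, map_zero]

end GenericInvertibility

/-! ### The WDVV metric as a Monge metric -/

section WDVVMetric

variable {N : ℕ} [NeZero N]

/-- The Bianchi identity with `S` as the fixed argument. Taking `S = E_m` and `S = B_ρ` treats the
linear and constant parts of affine expressions. -/
theorem psiTwo_cyclic {η : Matrix (Fin N) (Fin N) ℝ} (hsymm : η.IsSymm)
    {S : Matrix (Fin N) (Fin N) ℝ} (hS : Sᵀ = S) (i j k : WIdx N) :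
    ∑ γ : WIdx N, ∑ δ : WIdx N, phiCoeff η γ δ *
      (twistedBracket η⁻¹ S (symUnit i) γ.beta γ.nu * psiTwo η δ j k
      + twistedBracket η⁻¹ S (symUnit j) γ.beta γ.nu * psiTwo η δ k i
      + twistedBracket η⁻¹ S (symUnit k) γ.beta γ.nu * psiTwo η δ i j) = 0 := by
  have := bracketForm_bianchi hsymm hS (symUnit_transpose i) (symUnit_transpose k)
    (symUnit_transpose j)
  rw [← this]
  simp only [bracketForm, psiTwo_eq hsymm, ← Finset.sum_add_distrib]
  refine Finset.sum_congr rfl fun γ _ => Finset.sum_congr rfl fun δ _ => ?_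
  ring

theorem isMongeFactor_psiMat (hN : 2 ≤ N) {η : Matrix (Fin N) (Fin N) ℝ} (hsymm : η.IsSymm)
    (hdet : η.det ≠ 0) {p : Fin N} (hp : p ≠ 0) :
    IsMongeFactor (psiTwo η) (Matrix.of (phiCoeff η))
      (psiMat η p (fun I => (jetU I 0 : DiffFun (WIdx N)))) where
  skew γ k m := by
    rw [psiTwo_eq hsymm, psiTwo_eq hsymm, twistedBracket_swap, Matrix.neg_apply]
  symm := Matrix.IsSymm.ext fun γ δ => phiCoeff_comm hsymm δ γ
  det_form := det_phiCoeff_ne_zero hsymm hdet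
  det_factor := det_psiMat_jet_ne_zero hN hsymm hdet hp
  deriv d γ k := by
    simp [psiMat, Derivation.leibniz]
  cyclic i j k := by
    set C := algebraMap ℝ (DiffFun (WIdx N))
    have hω := psiTwo_cyclic hsymm (borderMat_transpose η p) i j k
    have hψ := fun m : WIdx N => psiTwo_cyclic hsymm (symUnit_transpose m) i j k
    simp only [← psiTwo_eq hsymm] at hψ
    simp only [← omegaCoeff_eq hsymm hdet] at hω
    -- Expand in the field variables, so that every coefficient is a real identity of the form `hψ`
    -- or `hω`.
    have e : ∀ γ δ : WIdx N, C (phiCoeff η γ δ) *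
        (psiMat η p (fun I => (jetU I 0 : DiffFun (WIdx N))) γ i * C (psiTwo η δ j k)
        + psiMat η p (fun I => (jetU I 0 : DiffFun (WIdx N))) γ j * C (psiTwo η δ k i)
        + psiMat η p (fun I => (jetU I 0 : DiffFun (WIdx N))) γ k * C (psiTwo η δ i j)) =
        ∑ m, jetU m 0 * C (phiCoeff η γ δ * (psiTwo η γ i m * psiTwo η δ j k
          + psiTwo η γ j m * psiTwo η δ k i + psiTwo η γ k m * psiTwo η δ i j))
        + C (phiCoeff η γ δ * (omegaCoeff η p γ i * psiTwo η δ j k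
          + omegaCoeff η p γ j * psiTwo η δ k i + omegaCoeff η p γ k * psiTwo η δ i j)) := by
      intro γ δ
      have h1 : ∀ l : WIdx N, ∀ r : DiffFun (WIdx N),
          psiMat η p (fun I => (jetU I 0 : DiffFun (WIdx N))) γ l * r =
          ∑ m, C (psiTwo η γ l m) * jetU m 0 * r + C (omegaCoeff η p γ l) * r := by
        intro l r
        rw [← Finset.sum_mul, ← add_mul]
        rfl
      rw [h1, h1, h1]
      simp only [map_mul, map_add, mul_add, Finset.mul_sum, Finset.sum_add_distrib]
      have h2 : ∀ a b : ℝ, ∀ c : WIdx N → ℝ, ∑ m, C a * (C (c m) * jetU m 0 * C b) =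
          ∑ m, jetU m 0 * (C a * (C (c m) * C b)) :=
        fun a b c => Finset.sum_congr rfl fun m _ => by ring
      simp only [h2]
      ring
    simp only [Matrix.of_apply, e, Finset.sum_add_distrib, ← map_sum, hω, map_zero, add_zero]
    rw [Finset.sum_congr rfl fun γ _ => Finset.sum_comm, Finset.sum_comm]
    simp only [← Finset.mul_sum, ← map_sum, hψ, map_zero, mul_zero, Finset.sum_const_zero]

theorem wdvvMetric_eq (η : Matrix (Fin N) (Fin N) ℝ) (p : Fin N) :
    wdvvMetric η p = (psiMat η p (fun I => (jetU I 0 : DiffFun (WIdx N))))ᵀ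
      * constForm (Matrix.of (phiCoeff η)) * psiMat η p (fun I => jetU I 0) := by
  ext i j
  rw [IsMongeFactor.transpose_mul_constForm_mul_apply]
  rfl

theorem isHamiltonianSystem_flux (hN : 2 ≤ N) {η : Matrix (Fin N) (Fin N) ℝ}
    (hsymm : η.IsSymm) (hdet : η.det ≠ 0) {p μ : Fin N} (hp : p ≠ 0) (hμ : μ ≠ 0) :
    IsHamiltonianSystem (wdvvMetric η p)
      (flux η p μ (fun I => (jetU I 0 : DiffFun (WIdx N)))) := by
  rw [wdvvMetric_eq]
  refine (isMongeFactor_psiMat hN hsymm hdet hp).isHamiltonianSystem (omegaCoeff η p)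
    (omegaCoeff η μ) (xiCoeff η p μ) (fun γ k => rfl) (fun i j k => ?_) (fun k l => ?_)
  · have := psiTwo_cyclic hsymm (borderMat_transpose η μ) i j k
    simp only [← omegaCoeff_eq hsymm hdet] at this
    exact this
  · have hp' := borderMat_transpose η p
    have hμ' := borderMat_transpose η μ
    -- The compatibility of `ω` with `ξ` is the Bianchi identity for `B_p, E_k, B_μ, E_l`.
    have h1 := bracketForm_bianchi hsymm hp' (symUnit_transpose k) hμ' (symUnit_transpose l)
    have h2 := bracketForm_swap_right η (borderMat η p) (symUnit l) (symUnit k) (borderMat η μ)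
    have h3 := bracketForm_comm hsymm (borderMat η p) (borderMat η μ) (symUnit l) (symUnit k)
    have h4 := bracketForm_swap_right η (symUnit l) (symUnit k) (borderMat η p) (borderMat η μ)
    have e1 : ∑ γ : WIdx N, ∑ δ : WIdx N, Matrix.of (phiCoeff η) γ δ *
        (omegaCoeff η p γ k * omegaCoeff η μ δ l - omegaCoeff η p γ l * omegaCoeff η μ δ k) =
        bracketForm η (borderMat η p) (symUnit k) (borderMat η μ) (symUnit l)
        - bracketForm η (borderMat η p) (symUnit l) (borderMat η μ) (symUnit k) := by
      simp only [bracketForm, omegaCoeff_eq hsymm hdet, ← Finset.sum_sub_distrib, mul_sub,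
        Matrix.of_apply]
    have e2 : ∑ γ : WIdx N, ∑ δ : WIdx N, Matrix.of (phiCoeff η) γ δ *
        (psiTwo η γ k l * xiCoeff η p μ δ) =
        bracketForm η (symUnit l) (symUnit k) (borderMat η μ) (borderMat η p) := by
      simp only [bracketForm, psiTwo_eq hsymm, xiCoeff_eq hdet hp hμ, Matrix.of_apply]
    rw [e1, e2]
    linarith

end WDVVMetric

/-! ### The WDVV equations -/

section WDVVEquations

variable {N : ℕ}

theorem contDiffOn_tPartial {n : ℕ} {M : Set (Fin N → ℝ)} (hM : IsOpen M)
    {G : (Fin N → ℝ) → ℝ} (hG : ContDiffOn ℝ (n + 1 : ℕ) G M) (i : Fin N) :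
    ContDiffOn ℝ n (tPartial i G) M := by
  have h := hG.fderiv_of_isOpen hM (m := n) (by norm_cast)
  exact h.clm_apply contDiffOn_const

theorem tPartial_congr {M : Set (Fin N → ℝ)} (hM : IsOpen M) {G H : (Fin N → ℝ) → ℝ}
    (h : ∀ s ∈ M, G s = H s) (i : Fin N) {t : Fin N → ℝ} (ht : t ∈ M) :
    tPartial i G t = tPartial i H t := by
  have : G =ᶠ[nhds t] H := Filter.eventually_of_mem (hM.mem_nhds ht) h
  rw [tPartial, tPartial, this.fderiv_eq]

theorem tPartial_comm {M : Set (Fin N → ℝ)} (hM : IsOpen M) {G : (Fin N → ℝ) → ℝ}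
    (hG : ContDiffOn ℝ (2 : ℕ) G M) (i j : Fin N) {t : Fin N → ℝ} (ht : t ∈ M) :
    tPartial i (tPartial j G) t = tPartial j (tPartial i G) t := by
  have hat : ContDiffAt ℝ (2 : ℕ) G t := hG.contDiffAt (hM.mem_nhds ht)
  have hsym : IsSymmSndFDerivAt ℝ G t := hat.isSymmSndFDerivAt (by simp)
  have hd : DifferentiableAt ℝ (fderiv ℝ G) t :=
    (hat.fderiv_right (m := 1) (by norm_num)).differentiableAt (by norm_num)
  have e : ∀ i j : Fin N, tPartial i (tPartial j G) t =
      fderiv ℝ (fderiv ℝ G) t (Pi.single i 1) (Pi.single j 1) := by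
    intro i j
    change fderiv ℝ (fun s => fderiv ℝ G s (Pi.single j 1)) t (Pi.single i 1) = _
    rw [fderiv_clm_apply hd (differentiableAt_const _)]
    simp
  rw [e, e]
  exact hsym _ _

variable {M : Set (Fin N → ℝ)} {F : (Fin N → ℝ) → ℝ}

theorem third_swap_left (hM : IsOpen M) (hF : ContDiffOn ℝ (4 : ℕ) F M) (a b c : Fin N)
    {t : Fin N → ℝ} (ht : t ∈ M) : third F a b c t = third F b a c t :=
  tPartial_comm hM ((contDiffOn_tPartial (n := 3) hM hF c).of_le (by norm_cast)) a b ht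

theorem third_swap_right (hM : IsOpen M) (hF : ContDiffOn ℝ (4 : ℕ) F M) (a b c : Fin N)
    {t : Fin N → ℝ} (ht : t ∈ M) : third F a b c t = third F a c b t :=
  tPartial_congr hM (fun _ hs => tPartial_comm hM (hF.of_le (by norm_cast)) b c hs) a ht

theorem contDiffOn_third (hM : IsOpen M) (hF : ContDiffOn ℝ (4 : ℕ) F M) (a b c : Fin N) :
    ContDiffOn ℝ (1 : ℕ) (third F a b c) M :=
  contDiffOn_tPartial hM (contDiffOn_tPartial (n := 2) hM (contDiffOn_tPartial (n := 3) hM hF c) b)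
    a

theorem tPartial_third (hM : IsOpen M) (hF : ContDiffOn ℝ (4 : ℕ) F M) (a b c d : Fin N)
    {t : Fin N → ℝ} (ht : t ∈ M) : tPartial a (third F b c d) t = tPartial b (third F a c d) t :=
  tPartial_comm hM (contDiffOn_tPartial (n := 2) hM (contDiffOn_tPartial (n := 3) hM hF d) c) a b ht

variable [NeZero N] {η : Matrix (Fin N) (Fin N) ℝ}

theorem fieldMat_uField (hM : IsOpen M) (hF : ContDiffOn ℝ (4 : ℕ) F M)
    (hη : ∀ t ∈ M, ∀ α β : Fin N, third F 0 α β t = η α β) (ρ : Fin N) {t : Fin N → ℝ}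
    (ht : t ∈ M) :
    fieldMat η ρ (uField F ρ t) = Matrix.of fun a b => third F ρ a b t := by
  refine sum_symUnit_add_borderMat η ρ (S := Matrix.of fun a b => third F ρ a b t) ?_ fun b => ?_
  · ext a b
    exact third_swap_right hM hF ρ b a ht
  · rw [Matrix.of_apply, third_swap_left hM hF ρ 0 b ht, hη t ht]

/-- By symmetry of third derivatives both sums contract two matrices `(F_{ρab})` through `η⁻¹`. In
the second sum the two summation indices have to be exchanged. -/
theorem wdvvS_eq_twistedBracket (hM : IsOpen M) (hF : ContDiffOn ℝ (4 : ℕ) F M)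
    (hη : ∀ t ∈ M, ∀ α β : Fin N, third F 0 α β t = η α β) (hsymm : η.IsSymm) (p μ β ν : Fin N)
    {t : Fin N → ℝ} (ht : t ∈ M) : wdvvS η F p β μ ν t =
      twistedBracket η⁻¹ (fieldMat η p (uField F p t)) (fieldMat η μ (uField F μ t)) β ν := by
  have hh : ∀ a b, η⁻¹ b a = η⁻¹ a b := fun a b => congrFun (congrFun (inv_transpose hsymm) a) b
  rw [fieldMat_uField hM hF hη p ht, fieldMat_uField hM hF hη μ ht, twistedBracket,
    Matrix.sub_apply]
  have e1 : ∀ (ρ σ : Fin N) (β ν : Fin N), ((Matrix.of fun a b => third F ρ a b t) * η⁻¹ *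
      Matrix.of fun a b => third F σ a b t) β ν =
      ∑ l, ∑ m, η⁻¹ l m * (third F l ρ β t * third F m σ ν t) := by
    intro ρ σ β ν
    simp only [Matrix.mul_apply, Matrix.of_apply, Finset.sum_mul]
    rw [Finset.sum_comm]
    refine Finset.sum_congr rfl fun l _ => Finset.sum_congr rfl fun m _ => ?_
    rw [third_swap_left hM hF l ρ β ht, third_swap_right hM hF ρ l β ht,
      third_swap_left hM hF m σ ν ht]
    ring
  rw [e1, e1, Finset.sum_comm (f := fun l m => η⁻¹ l m * (third F l μ β t * third F m p ν t)),
    ← Finset.sum_sub_distrib]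
  refine Finset.sum_congr rfl fun l _ => ?_
  rw [← Finset.sum_sub_distrib]
  refine Finset.sum_congr rfl fun m _ => ?_
  rw [hh l m]
  ring

theorem wdvvS_eq (hM : IsOpen M) (hF : ContDiffOn ℝ (4 : ℕ) F M)
    (hη : ∀ t ∈ M, ∀ α β : Fin N, third F 0 α β t = η α β) (hsymm : η.IsSymm)
    (hdet : η.det ≠ 0) {p μ : Fin N} (hp : p ≠ 0) (hμ : μ ≠ 0) {t : Fin N → ℝ} (ht : t ∈ M)
    (γ : WIdx N) : wdvvS η F p γ.beta μ γ.nu t =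
      (psiMat η p (uField F p t) *ᵥ uField F μ t) γ - zVec η p μ (uField F p t) γ := by
  rw [wdvvS_eq_twistedBracket hM hF hη hsymm p μ _ _ ht, psiMat_mulVec_sub_zVec hsymm hdet hp hμ]

/-- The equations for all `β, ν` form a skew matrix, so those indexed by `γ` suffice, and they read
`ψ u_μ = Z_μ`. -/
theorem wdvvS_eq_zero_iff (hM : IsOpen M) (hF : ContDiffOn ℝ (4 : ℕ) F M)
    (hη : ∀ t ∈ M, ∀ α β : Fin N, third F 0 α β t = η α β) (hsymm : η.IsSymm)
    (hdet : η.det ≠ 0) {p μ : Fin N} (hp : p ≠ 0) (hμ : μ ≠ 0) {t : Fin N → ℝ} (ht : t ∈ M)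
    (hψ : (psiMat η p (uField F p t)).det ≠ 0) :
    (∀ β ν : Fin N, wdvvS η F p β μ ν t = 0) ↔ uField F μ t = flux η p μ (uField F p t) := by
  constructor
  · intro h
    have h1 : psiMat η p (uField F p t) *ᵥ uField F μ t = zVec η p μ (uField F p t) := by
      funext γ
      have := wdvvS_eq hM hF hη hsymm hdet hp hμ ht γ
      rw [h] at this
      linarith
    rw [flux, ← h1, Matrix.mulVec_mulVec, Matrix.nonsing_inv_mul _ hψ.isUnit, Matrix.one_mulVec]
  · intro h β ν
    have h1 : psiMat η p (uField F p t) *ᵥ uField F μ t = zVec η p μ (uField F p t) := by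
      rw [h, flux, Matrix.mulVec_mulVec, Matrix.mul_nonsing_inv _ hψ.isUnit, Matrix.one_mulVec]
    have hs : ∀ (ρ : Fin N) (u : WIdx N → ℝ), (fieldMat η ρ u)ᵀ = fieldMat η ρ u := by
      intro ρ u
      rw [fieldMat, Matrix.transpose_add, sum_symUnit_transpose, borderMat_transpose]
    have h0 := skew_eq_zero (twistedBracket_transpose (inv_transpose hsymm)
      (hs p (uField F p t)) (hs μ (uField F μ t))) fun γ => by
        rw [← psiMat_mulVec_sub_zVec hsymm hdet hp hμ, h1, sub_self]
    rw [wdvvS_eq_twistedBracket hM hF hη hsymm p μ β ν ht, h0]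
    rfl

theorem continuous_det_psiMat (η : Matrix (Fin N) (Fin N) ℝ) (p : Fin N) :
    Continuous fun u : WIdx N → ℝ => (psiMat η p u).det := by
  apply Continuous.matrix_det
  refine continuous_matrix fun γ k => ?_
  simp only [psiMat, Matrix.of_apply]
  fun_prop

theorem differentiableAt_third (hM : IsOpen M) (hF : ContDiffOn ℝ (4 : ℕ) F M) (a b c : Fin N)
    {t : Fin N → ℝ} (ht : t ∈ M) : DifferentiableAt ℝ (third F a b c) t :=
  ((contDiffOn_third hM hF a b c).contDiffAt (hM.mem_nhds ht)).differentiableAt (by norm_num)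

/-- The condition `det ψ ≠ 0` is open, so the flux coincides near `t` with a third derivative of
`F`. Its differentiability follows from this, and the law is the equality of mixed fourth
derivatives. -/
theorem conservation_law (hM : IsOpen M) (hF : ContDiffOn ℝ (4 : ℕ) F M)
    (hη : ∀ t ∈ M, ∀ α β : Fin N, third F 0 α β t = η α β) (hsymm : η.IsSymm)
    (hdet : η.det ≠ 0) {p μ : Fin N} (hp : p ≠ 0) (hμ : μ ≠ 0)
    (h : ∀ t ∈ M, ∀ β ν : Fin N, wdvvS η F p β μ ν t = 0) {t : Fin N → ℝ} (ht : t ∈ M)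
    (hψ : (psiMat η p (uField F p t)).det ≠ 0) (I : WIdx N) :
    DifferentiableAt ℝ (fun s => uField F p s I) t ∧
    DifferentiableAt ℝ (fun s => flux η p μ (uField F p s) I) t ∧
    tPartial μ (fun s => uField F p s I) t =
      tPartial p (fun s => flux η p μ (uField F p s) I) t := by
  have hc : ContinuousAt (fun s => (psiMat η p (uField F p s)).det) t := by
    refine (continuous_det_psiMat η p).continuousAt.comp (continuousAt_pi.2 fun J => ?_)
    exact (differentiableAt_third hM hF p J.1.2 J.1.1 ht).continuousAt
  have hev : (fun s => flux η p μ (uField F p s) I) =ᶠ[nhds t] fun s => uField F μ s I := by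
    filter_upwards [hc.eventually_ne hψ, hM.mem_nhds ht] with s hs hsM
    rw [← (wdvvS_eq_zero_iff hM hF hη hsymm hdet hp hμ hsM hs).1 (h s hsM)]
  refine ⟨differentiableAt_third hM hF p I.1.2 I.1.1 ht,
    (differentiableAt_third hM hF μ I.1.2 I.1.1 ht).congr_of_eventuallyEq hev, ?_⟩
  have : tPartial p (fun s => flux η p μ (uField F p s) I) t =
      tPartial p (fun s => uField F μ s I) t := by
    rw [tPartial, tPartial, hev.fderiv_eq]
  rw [this]
  exact tPartial_third hM hF μ p I.1.2 I.1.1 ht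

end WDVVEquations

/-! ### The Hamiltonian structure of the WDVV systems -/

theorem theorem4 (N : ℕ) [NeZero N] (hN : 3 ≤ N) (η : Matrix (Fin N) (Fin N) ℝ)
    (hsymm : η.IsSymm) (hdet : η.det ≠ 0) (p : Fin N) (hp : p ≠ 0) :
    -- the matrix `ψ(u)` is generically invertible, and `f` is a Monge metric
    (psiMat η p (fun I => (jetU I 0 : DiffFun (WIdx N)))).det ≠ 0 ∧
    IsMongeMetric (wdvvMetric η p) ∧
    -- the Doyle--Potëmin operator of `f` is Hamiltonian
    IsHamiltonianOperator (doylePotemin (wdvvMetric η p)) ∧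
    ∀ μ : Fin N, μ ≠ 0 → μ ≠ p →
      -- the system `(u^I_p)_μ = (V^I_μ)_p` is Hamiltonian with respect to this operator
      IsHamiltonianSystem (wdvvMetric η p)
        (flux η p μ (fun I => (jetU I 0 : DiffFun (WIdx N)))) ∧
      -- the system is obtained from the WDVV equations
      ∀ (M : Set (Fin N → ℝ)) (F : (Fin N → ℝ) → ℝ), IsOpen M → ContDiffOn ℝ 4 F M →
        (∀ t ∈ M, ∀ α β : Fin N, third F 0 α β t = η α β) →
        (∀ t ∈ M, ∀ γ : WIdx N, wdvvS η F p γ.beta μ γ.nu t =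
          (psiMat η p (uField F p t) *ᵥ uField F μ t) γ - zVec η p μ (uField F p t) γ) ∧
        (∀ t ∈ M, (psiMat η p (uField F p t)).det ≠ 0 →
          ((∀ β ν : Fin N, wdvvS η F p β μ ν t = 0) ↔
            uField F μ t = flux η p μ (uField F p t))) ∧
        ((∀ t ∈ M, ∀ β ν : Fin N, wdvvS η F p β μ ν t = 0) →
          ∀ t ∈ M, (psiMat η p (uField F p t)).det ≠ 0 → ∀ I : WIdx N,
            DifferentiableAt ℝ (fun s => uField F p s I) t ∧
            DifferentiableAt ℝ (fun s => flux η p μ (uField F p s) I) t ∧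
            tPartial μ (fun s => uField F p s I) t =
              tPartial p (fun s => flux η p μ (uField F p s) I) t) := by
  have hN2 : 2 ≤ N := by omega
  have hfac := isMongeFactor_psiMat hN2 hsymm hdet hp
  refine ⟨hfac.det_factor, ?_, ?_, fun μ hμ _ =>
    ⟨isHamiltonianSystem_flux hN2 hsymm hdet hp hμ, fun M F hM hF hη => ⟨?_, ?_, ?_⟩⟩⟩
  · rw [wdvvMetric_eq]
    exact hfac.isMongeMetric
  · rw [wdvvMetric_eq]
    exact hfac.isHamiltonianOperator
  · exact fun t ht γ => wdvvS_eq hM hF hη hsymm hdet hp hμ ht γ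
  · exact fun t ht hψ => wdvvS_eq_zero_iff hM hF hη hsymm hdet hp hμ ht hψ
  · exact fun h t ht hψ I => conservation_law hM hF hη hsymm hdet hp hμ h ht hψ I
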